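/- A *projective algebraic manifold* is a closed complex submanifold $M$ of a complex projective space $\mathbb{CP}^n$, and a *quasi-projective manifold* is a Zariski open subset $Y$ of such an $M$ (that is, the complement in $M$ of the common zero set of a family of homogeneous polynomials). A *spray* on a complex manifold $Y$ is a holomorphic map $s\colon E\to Y$ from the total space of a holomorphic vector bundle $E\to Y$ such that $s(0_y)=y$ for all $y\in Y$; here $0_y$ is the zero of the fibre $E_y$. The manifold $Y$ is *subelliptic* if it admits finitely many sprays $s_j\colon E_j\to Y$ $(j=1,\dots,k)$ such that $$(ds_1)_{0_y}(E_{1,y})+\cdots+(ds_k)_{0_y}(E_{k,y})=T_yY\qquad(*)$$ for every $y\in Y$. If $U\subset Y$ is Zariski open, an *algebraic spray on $U$ with values in $Y$* is an algebraic map $s\colon E\to Y$ from the total space of an algebraic vector bundle $E\to U$ such that $s(0_u)=u$ for all $u\in U$; its range need not be contained in $U$. **Proposition 1.3.** Let $Y$ be a quasi-projective manifold. Suppose that each point $y\in Y$ has a Zariski open neighbourhood $U\subset Y$ and finitely many algebraic sprays $s_j\colon E_j\to Y$ $(j=1,\dots,k)$, defined on algebraic vector bundles $E_j\to U$ and with values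 in $Y$, which satisfy $(*)$ at the point $y$. Then $Y$ is subelliptic. -/

import Mathlib

open Manifold Bundle Topology Set
open scoped ContDiff LinearAlgebra.Projectivization

noncomputable section

/-! ## Complex projective space as a complex manifold -/

/-- Complex projective space of dimension `n`: the lines through the origin in `ℂ^(n+1)`. -/
abbrev CPn (n : ℕ) : Type := ℙ ℂ (Fin (n + 1) → ℂ)

namespace CPn

variable {n : ℕ}

/-- The quotient topology from `ℂ^(n+1) \ {0}`. -/
instance : TopologicalSpace (CPn n) :=
  inferInstanceAs (TopologicalSpace (Quotient (projectivizationSetoid ℂ (Fin (n + 1) → ℂ))))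

lemma isQuotientMap_mk' : IsQuotientMap (Projectivization.mk' ℂ : _ → CPn n) :=
  isQuotientMap_quotient_mk'

/-- The affine coordinates `Z_l / Z_i` (`l ≠ i`) of the point `[Z_0 : ... : Z_n]`. -/
def affineCoord (i : Fin (n + 1)) (p : CPn n) : Fin n → ℂ :=
  fun j => p.rep (i.succAbove j) / p.rep i

/-- The point with affine coordinates `w`: the `i`-th homogeneous coordinate is `1`, the others
are the entries of `w`. -/
def ofAffine (i : Fin (n + 1)) (w : Fin n → ℂ) : CPn n :=
  Projectivization.mk ℂ (i.insertNth (1 : ℂ) w : Fin (n + 1) → ℂ)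
    (fun h => by simpa using congrFun h i)

lemma rep_mk_apply (v : Fin (n + 1) → ℂ) (hv : v ≠ 0) :
    ∃ a : ℂˣ, ∀ l, (Projectivization.mk ℂ v hv : CPn n).rep l = (a : ℂ) * v l := by
  obtain ⟨a, ha⟩ := Projectivization.exists_smul_eq_mk_rep ℂ v hv
  exact ⟨a, fun l => by rw [← ha]; rfl⟩

lemma rep_mk_ne_zero_iff (v : Fin (n + 1) → ℂ) (hv : v ≠ 0) (i : Fin (n + 1)) :
    (Projectivization.mk ℂ v hv : CPn n).rep i ≠ 0 ↔ v i ≠ 0 := by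
  obtain ⟨a, ha⟩ := rep_mk_apply v hv
  simp [ha]

lemma affineCoord_mk (v : Fin (n + 1) → ℂ) (hv : v ≠ 0) (i : Fin (n + 1)) :
    affineCoord i (Projectivization.mk ℂ v hv) = fun j => v (i.succAbove j) / v i := by
  obtain ⟨a, ha⟩ := rep_mk_apply v hv
  funext j
  simp only [affineCoord, ha]
  rw [mul_div_mul_left _ _ a.ne_zero]

lemma affineCoord_ofAffine (i : Fin (n + 1)) (w : Fin n → ℂ) :
    affineCoord i (ofAffine i w) = w := by
  rw [ofAffine, affineCoord_mk]
  simp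

lemma ofAffine_affineCoord (i : Fin (n + 1)) (p : CPn n) (hp : p.rep i ≠ 0) :
    ofAffine i (affineCoord i p) = p := by
  rw [← p.mk_rep, ofAffine, Projectivization.mk_eq_mk_iff']
  refine ⟨(p.rep i)⁻¹, ?_⟩
  simp only [p.mk_rep]
  funext l
  refine Fin.succAboveCases i ?_ (fun j => ?_) l
  · simp [hp]
  · simp [affineCoord, div_eq_inv_mul]

lemma isOpen_coord_ne_zero (i : Fin (n + 1)) : IsOpen {p : CPn n | p.rep i ≠ 0} := by
  rw [← isQuotientMap_mk'.isOpen_preimage]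
  have : (Projectivization.mk' ℂ : _ → CPn n) ⁻¹' {p | p.rep i ≠ 0} =
      {v : {v : Fin (n + 1) → ℂ // v ≠ 0} | v.1 i ≠ 0} := by
    ext v
    exact rep_mk_ne_zero_iff v.1 v.2 i
  rw [this]
  exact isOpen_ne_fun ((continuous_apply i).comp continuous_subtype_val) continuous_const

/-- The standard affine chart on `{Z_i ≠ 0}`. -/
def affineChart (i : Fin (n + 1)) : OpenPartialHomeomorph (CPn n) (Fin n → ℂ) where
  toFun := affineCoord i
  invFun := ofAffine i
  source := {p | p.rep i ≠ 0}
  target := univ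
  map_source' _ _ := mem_univ _
  map_target' w _ := by
    refine (rep_mk_ne_zero_iff _ _ i).2 ?_
    simp
  left_inv' p hp := ofAffine_affineCoord i p hp
  right_inv' w _ := affineCoord_ofAffine i w
  open_source := isOpen_coord_ne_zero i
  open_target := isOpen_univ
  continuousOn_toFun := by
    rw [isQuotientMap_mk'.continuousOn_isOpen_iff (isOpen_coord_ne_zero i)]
    have : ContinuousOn (fun (v : {v : Fin (n + 1) → ℂ // v ≠ 0}) (j : Fin n) =>
        v.1 (i.succAbove j) / v.1 i) ((Projectivization.mk' ℂ : _ → CPn n) ⁻¹' {p | p.rep i ≠ 0}) := by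
      refine continuousOn_pi.2 fun j => ContinuousOn.div
        ((continuous_apply _).comp continuous_subtype_val).continuousOn
        ((continuous_apply _).comp continuous_subtype_val).continuousOn ?_
      intro v hv
      exact (rep_mk_ne_zero_iff v.1 v.2 i).1 hv
    refine this.congr fun v _ => ?_
    exact affineCoord_mk v.1 v.2 i
  continuousOn_invFun := by
    refine Continuous.continuousOn ?_
    have h : Continuous (fun w : Fin n → ℂ =>
        (⟨i.insertNth (1 : ℂ) w, fun h => by simpa using congrFun h i⟩ :
          {v : Fin (n + 1) → ℂ // v ≠ 0})) := by
      refine Continuous.subtype_mk ?_ _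
      exact Continuous.finInsertNth i continuous_const continuous_id
    exact isQuotientMap_mk'.continuous.comp h

lemma exists_rep_ne_zero (p : CPn n) : ∃ i, p.rep i ≠ 0 := by
  by_contra! h
  exact p.rep_nonzero (funext h)

instance : ChartedSpace (Fin n → ℂ) (CPn n) where
  atlas := range affineChart
  chartAt p := affineChart (exists_rep_ne_zero p).choose
  mem_chart_source p := (exists_rep_ne_zero p).choose_spec
  chart_mem_atlas _ := mem_range_self _

instance : IsManifold 𝓘(ℂ, Fin n → ℂ) ω (CPn n) := by
  refine isManifold_of_contDiffOn _ _ _ ?_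
  rintro _ _ ⟨i, rfl⟩ ⟨k, rfl⟩
  have hcoord : ∀ l : Fin (n + 1),
      ContDiff ℂ ω (fun w : Fin n → ℂ => (i.insertNth (1 : ℂ) w : Fin (n + 1) → ℂ) l) := by
    intro l
    refine Fin.succAboveCases i ?_ (fun j => ?_) l
    · simpa using contDiff_const
    · simpa using contDiff_apply ℂ ℂ j
  have : ContDiffOn ℂ ω (fun (w : Fin n → ℂ) (j : Fin n) =>
      (i.insertNth (1 : ℂ) w : Fin (n + 1) → ℂ) (k.succAbove j) /
        (i.insertNth (1 : ℂ) w : Fin (n + 1) → ℂ) k)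
      {w | (i.insertNth (1 : ℂ) w : Fin (n + 1) → ℂ) k ≠ 0} := by
    refine contDiffOn_pi.2 fun j => ContDiffOn.div (hcoord _).contDiffOn (hcoord _).contDiffOn ?_
    exact fun w hw => hw
  refine (this.mono ?_).congr ?_
  · intro w hw
    simp only [mfld_simps] at hw
    exact (rep_mk_ne_zero_iff _ _ k).1 hw.2
  · intro w _
    exact affineCoord_mk _ _ k

end CPn

/-! ## The Zariski topology, regular functions and regular maps

Everything is expressed for a set `B` with a map `κ : B → CPn n` (below: the inclusion of a
subset of projective space), so that points of `B` have homogeneous coordinates. -/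

section Regular

variable {n : ℕ} {B : Type*}

/-- `S ⊆ B` is Zariski open: it is the complement of the common zero set of some homogeneous
polynomials. (Vanishing does not depend on the representative.) -/
def IsZariskiOpen (κ : B → CPn n) (S : Set B) : Prop :=
  ∃ A : Set (MvPolynomial (Fin (n + 1)) ℂ), (∀ P ∈ A, ∃ m, P.IsHomogeneous m) ∧
    S = {b | ∃ P ∈ A, MvPolynomial.eval (κ b).rep P ≠ 0}

/-- `f` is a regular function on the (Zariski open) set `S`: Zariski-locally it is a quotient
of homogeneous polynomials of equal degree. -/
def IsRegularFun (κ : B → CPn n) (S : Set B) (f : B → ℂ) : Prop :=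
  ∀ b ∈ S, ∃ (m : ℕ) (P Q : MvPolynomial (Fin (n + 1)) ℂ),
    P.IsHomogeneous m ∧ Q.IsHomogeneous m ∧ MvPolynomial.eval (κ b).rep Q ≠ 0 ∧
    ∀ b' ∈ S, MvPolynomial.eval (κ b').rep Q ≠ 0 →
      f b' = MvPolynomial.eval (κ b').rep P / MvPolynomial.eval (κ b').rep Q

/-- The vector of values at homogeneous coordinates `z` and `t ∈ ℂ^r` of a tuple of polynomials
in the variables `z` and `t`. -/
def evalTuple {r : ℕ} (P : Fin (n + 1) → MvPolynomial (Fin (n + 1) ⊕ Fin r) ℂ)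
    (z : Fin (n + 1) → ℂ) (t : Fin r → ℂ) : Fin (n + 1) → ℂ :=
  fun i => MvPolynomial.eval (Sum.elim z t) (P i)

/-- `g : S × ℂ^r → CPn n` is a regular map on the product of the (Zariski open) set `S`
with affine space: Zariski-locally it is given in homogeneous coordinates by a
tuple of polynomials in `(z, t)` which are homogeneous of one and the same degree in the
homogeneous coordinates `z` of `S`. (The set where the tuple does not vanish is Zariski open.) -/
def IsRegularMap {r : ℕ} (κ : B → CPn n) (S : Set B) (g : B → (Fin r → ℂ) → CPn n) : Prop :=
  ∀ b ∈ S, ∀ t : Fin r → ℂ,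
    ∃ (m : ℕ) (P : Fin (n + 1) → MvPolynomial (Fin (n + 1) ⊕ Fin r) ℂ),
      (∀ i, (P i).IsWeightedHomogeneous (Sum.elim (fun _ => 1) (fun _ => 0)) m) ∧
      evalTuple P (κ b).rep t ≠ 0 ∧
      ∀ b' ∈ S, ∀ (t' : Fin r → ℂ) (h : evalTuple P (κ b').rep t' ≠ 0),
        g b' t' = Projectivization.mk ℂ (evalTuple P (κ b').rep t') h

end Regular

/-! ## Vector bundles and sprays -/

/-- A (topological) complex vector bundle of finite rank over `B`, bundled. -/
structure ComplexVB (B : Type*) [TopologicalSpace B] where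
  rank : ℕ
  Fib : B → Type
  [acg : ∀ b, AddCommGroup (Fib b)]
  [mod : ∀ b, Module ℂ (Fib b)]
  [topFib : ∀ b, TopologicalSpace (Fib b)]
  [topTotal : TopologicalSpace (TotalSpace (Fin rank → ℂ) Fib)]
  [fiberBundle : FiberBundle (Fin rank → ℂ) Fib]
  [vectorBundle : VectorBundle ℂ (Fin rank → ℂ) Fib]

namespace ComplexVB

attribute [instance] acg mod topFib topTotal fiberBundle vectorBundle

variable {B : Type*} [TopologicalSpace B]

/-- The model fibre `ℂ^rank`. -/
abbrev F (E : ComplexVB B) : Type := Fin E.rank → ℂ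

/-- The total space. -/
abbrev Total (E : ComplexVB B) := TotalSpace E.F E.Fib

/-- The image `(ds)_{0_b}(E_b)` of the fibre `E_b ⊆ T_{0_b} E` under the differential at `0_b` of
a map `s` from the total space to a complex manifold `X` of dimension `d`, that is, the range of the
differential at `0` of the restriction `E_b → X` of `s`; the fibre `E_b` is identified
linearly with `ℂ^rank` by a local trivialization, which does not affect the range.
In Mathlib the tangent space of `X` at each point is the model space `ℂ^d` (by means of
the preferred chart at that point); for a spray the point is `s(0_b) = b`. -/
def verticalImage (E : ComplexVB B) {d : ℕ} {X : Type*} [TopologicalSpace X]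
    [ChartedSpace (Fin d → ℂ) X] (s : E.Total → X) (b : B) : Submodule ℂ (Fin d → ℂ) :=
  LinearMap.range (mfderiv 𝓘(ℂ, E.F) 𝓘(ℂ, Fin d → ℂ)
    (fun v : E.F => s ⟨b, (trivializationAt E.F E.Fib b).symm b v⟩) 0).toLinearMap

end ComplexVB

/-- A (holomorphic) spray on a complex manifold `X` of dimension `d`: a holomorphic vector bundle
`E → X` with a holomorphic map `s : E → X` such that `s(0_x) = x`. -/
structure HolomorphicSpray (d : ℕ) (X : Type*) [TopologicalSpace X]
    [ChartedSpace (Fin d → ℂ) X] extends ComplexVB X where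
  holomorphicBundle : ContMDiffVectorBundle ω (Fin rank → ℂ) Fib 𝓘(ℂ, Fin d → ℂ)
  toFun : toComplexVB.Total → X
  holomorphic : ContMDiff (𝓘(ℂ, Fin d → ℂ).prod 𝓘(ℂ, Fin rank → ℂ)) 𝓘(ℂ, Fin d → ℂ) ω toFun
  map_zero : ∀ x, toFun ⟨x, 0⟩ = x

/-- A complex manifold is subelliptic if it admits finitely many sprays `s_1, ..., s_k` with
`(ds_1)_{0_x}(E_{1,x}) + ... + (ds_k)_{0_x}(E_{k,x}) = T_x X` for all `x`. -/
def IsSubelliptic (d : ℕ) (X : Type*) [TopologicalSpace X] [ChartedSpace (Fin d → ℂ) X] : Prop :=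
  ∃ (k : ℕ) (σ : Fin k → HolomorphicSpray d X),
    ∀ x : X, ⨆ j, (σ j).verticalImage (σ j).toFun x = (⊤ : Submodule ℂ (Fin d → ℂ))

/-- An algebraic vector bundle over (a subset `B` of projective space, with inclusion) `κ`:
a vector bundle with an atlas of linear trivializations over Zariski open sets, the transition
matrices between which have regular entries. -/
structure AlgebraicVB {n : ℕ} {B : Type*} [TopologicalSpace B] (κ : B → CPn n)
    extends ComplexVB B where
  algAtlas : Set (Trivialization (Fin rank → ℂ) (π (Fin rank → ℂ) Fib))
  isLinear : ∀ e ∈ algAtlas, e.IsLinear ℂ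
  isZariskiOpen_baseSet : ∀ e ∈ algAtlas, IsZariskiOpen κ e.baseSet
  cover : ∀ b, ∃ e ∈ algAtlas, b ∈ e.baseSet
  isRegular_transition : ∀ e ∈ algAtlas, ∀ e' ∈ algAtlas, ∀ i j : Fin rank,
    IsRegularFun κ (e.baseSet ∩ e'.baseSet)
      (fun b => (e' ⟨b, e.symm b (Pi.single j 1)⟩).2 i)

/-- For open subsets `U`, `Y` of `M`, with `M` embedded in projective space by `ι`: an algebraic
spray `s : E → Y` defined on an algebraic vector bundle `E → U` and with values in `Y`. That `s` is
algebraic means that it is a regular map in each algebraic trivialization of `E`. -/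
structure AlgebraicSpray {n : ℕ} {M : Type*} [TopologicalSpace M] (ι : M → CPn n)
    (U Y : TopologicalSpace.Opens M) extends AlgebraicVB (fun u : U => ι u) where
  toFun : toComplexVB.Total → Y
  isRegular : ∀ e ∈ algAtlas, IsRegularMap (fun u : U => ι u) e.baseSet
    (fun u (t : Fin rank → ℂ) => ι (toFun ⟨u, e.symm u t⟩))
  map_zero : ∀ u : U, (toFun ⟨u, 0⟩ : M) = u

end

/-! Let `κ : Y → ℂℙ^n` be the inclusion. Sprays on the whole of `Y` are obtained from local algebraic
ones by Gromov's twisting: multiply the fibre variable by a polynomial that vanishes outside of the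
domain of the spray, at the price of a twist of the bundle by a power of the tautological bundle.

*Reduction to line bundles.* The vertical derivatives of an algebraic spray `s` are the velocities
at `t = 0` of the curves `t ↦ s (t a)`, where `a ∈ ℂ^r` is a vector in an algebraic trivialization.
For fixed `a` they form a regular family of curves `γ x` with `γ x 0 = x` on a set `{K ≠ 0}`
(`AlgebraicSpray.isRegularCurves`), and it suffices to extend such families.

*Extension* (`IsRegularCurves.exists_extension`, `IsRegularCurves.exists_spray`). Near `(y, 0)` the
family is given in homogeneous coordinates `z` by a tuple `P (z, t) = P (z, 0) + t P₁ (z, t)`. As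
`γ x 0 = x`, it satisfies `z_i P (z, 0) = D z` with `D = P_i (z, 0)`. Let `B = z_i D K` and `c = B D`.
Then `z_i P (z, c t) = D F (z, t)`, where `F (z, t) = z + z_i B t P₁ (z, c t)` equals `z` wherever
`c = 0`. Thus the curves `t ↦ γ x (c t)`, defined where `c ≠ 0`, and the constant curves at the
points where `c = 0` are described near the zeros of `c` by the single holomorphic formula `[F]`,
and together they form a holomorphic map. Since `c` is homogeneous of some degree `e`, the time `t`
is a fibre coordinate on the `e`-th power of the tautological bundle, on which one obtains a
spray (`lineSpray`).

*Domination.* The velocities of the extended spray are classes modulo `z` of vectors `W (z)` with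
polynomial entries. As `κ` is an immersion, `d` such sprays dominate at a point if and only
if `z, W₁ (z), …, W_d (z)` are linearly independent. At `y` this can be achieved by assumption, it
is a Zariski open condition (`exists_polynomial_linearIndependent`), and by Hilbert's basis theorem
(`exists_finset_eval_ne_zero`) finitely many points `y` suffice. -/

noncomputable section

/-! ### Velocities of curves -/

section Velocity

variable {E F : Type*} [NormedAddCommGroup E] [NormedSpace ℂ E] [NormedAddCommGroup F]
  [NormedSpace ℂ F] {M N : Type*} [TopologicalSpace M] [ChartedSpace E M]
  [TopologicalSpace N] [ChartedSpace F N]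

variable (E) in
/-- The velocity at time `0` of a curve in a complex manifold, as an element of the model space
(to which Mathlib's tangent spaces are by definition equal). -/
def velocity (γ : ℂ → M) : E :=
  (show ℂ →L[ℂ] E from mfderiv 𝓘(ℂ, ℂ) 𝓘(ℂ, E) γ 0) (1 : ℂ)

variable (E F) in
/-- The differential of a map between complex manifolds, as a linear map between the
model spaces. -/
def differential (f : M → N) (x : M) : E →L[ℂ] F := mfderiv 𝓘(ℂ, E) 𝓘(ℂ, F) f x

lemma velocity_comp {γ : ℂ → M} {f : M → N} {x : M} (hx : γ 0 = x)
    (hf : MDifferentiableAt 𝓘(ℂ, E) 𝓘(ℂ, F) f x)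
    (hγ : MDifferentiableAt 𝓘(ℂ, ℂ) 𝓘(ℂ, E) γ 0) :
    velocity F (f ∘ γ) = differential E F f x (velocity E γ) := by
  subst hx
  exact congrArg (fun L : ℂ →L[ℂ] F => L 1) (mfderiv_comp (0 : ℂ) hf hγ)

lemma velocity_congr {γ γ' : ℂ → M} (h : γ =ᶠ[𝓝 0] γ') :
    velocity E γ = velocity E γ' :=
  congrArg (fun L : ℂ →L[ℂ] E => L 1) (h.mfderiv_eq (I := 𝓘(ℂ, ℂ)) (I' := 𝓘(ℂ, E)))

lemma velocity_eq_deriv (γ : ℂ → E) : velocity E γ = deriv γ 0 := by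
  rw [velocity, mfderiv_eq_fderiv]
  rfl

end Velocity

/-! ### Homogeneous coordinates and the projection to projective space -/

namespace CPn

variable {n : ℕ}

/-- The projection `ℂ^(n+1) \ {0} → ℂℙ^n`, extended to `0` by a junk value. -/
def proj (v : Fin (n + 1) → ℂ) : CPn n :=
  if h : v ≠ 0 then Projectivization.mk ℂ v h
  else Projectivization.mk ℂ (fun _ => 1) (fun h => one_ne_zero (congrFun h 0))

lemma proj_of_ne_zero {v : Fin (n + 1) → ℂ} (hv : v ≠ 0) :
    proj v = Projectivization.mk ℂ v hv := dif_pos hv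

lemma proj_rep (p : CPn n) : proj p.rep = p := by
  rw [proj_of_ne_zero p.rep_nonzero, p.mk_rep]

lemma proj_smul {c : ℂ} (hc : c ≠ 0) {v : Fin (n + 1) → ℂ} (hv : v ≠ 0) :
    proj (c • v) = proj v := by
  rw [proj_of_ne_zero hv, proj_of_ne_zero (smul_ne_zero hc hv), Projectivization.mk_eq_mk_iff']
  exact ⟨c, rfl⟩

lemma exists_smul_of_proj_eq {v w : Fin (n + 1) → ℂ} (hv : v ≠ 0) (hw : w ≠ 0)
    (h : proj v = proj w) : ∃ c : ℂ, c ≠ 0 ∧ v = c • w := by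
  rw [proj_of_ne_zero hv, proj_of_ne_zero hw, Projectivization.mk_eq_mk_iff'] at h
  obtain ⟨a, ha⟩ := h
  refine ⟨a, ?_, ha.symm⟩
  rintro rfl
  exact hv (by simpa using ha.symm)

/-- The homogeneous coordinates of a point with `Z_i ≠ 0` which are normalized by `Z_i = 1`. -/
def normCoord (i : Fin (n + 1)) (p : CPn n) : Fin (n + 1) → ℂ := (p.rep i)⁻¹ • p.rep

lemma normCoord_ne_zero {i : Fin (n + 1)} {p : CPn n} (hp : p.rep i ≠ 0) :
    normCoord i p ≠ 0 :=
  smul_ne_zero (inv_ne_zero hp) p.rep_nonzero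

lemma normCoord_proj {v : Fin (n + 1) → ℂ} (i : Fin (n + 1)) (hv : v i ≠ 0) :
    normCoord i (proj v) = (v i)⁻¹ • v := by
  have hv0 : v ≠ 0 := fun h => hv (by simp [h])
  obtain ⟨a, ha⟩ := rep_mk_apply v hv0
  rw [proj_of_ne_zero hv0]
  funext l
  simp only [normCoord, Pi.smul_apply, ha, smul_eq_mul, mul_inv]
  field_simp [a.ne_zero]

lemma rep_proj_ne_zero_iff {v : Fin (n + 1) → ℂ} (hv : v ≠ 0) (i : Fin (n + 1)) :
    (proj v).rep i ≠ 0 ↔ v i ≠ 0 := by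
  rw [proj_of_ne_zero hv, rep_mk_ne_zero_iff]

lemma affineChart_mem_maximalAtlas (i : Fin (n + 1)) :
    affineChart i ∈ IsManifold.maximalAtlas 𝓘(ℂ, Fin n → ℂ) ω (CPn n) :=
  IsManifold.subset_maximalAtlas (mem_range_self i)

lemma contMDiffOn_normCoord (i : Fin (n + 1)) :
    ContMDiffOn 𝓘(ℂ, Fin n → ℂ) 𝓘(ℂ, Fin (n + 1) → ℂ) ω (normCoord i)
      {p : CPn n | p.rep i ≠ 0} := by
  have h1 := contMDiffOn_of_mem_maximalAtlas (affineChart_mem_maximalAtlas (n := n) i)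
  have h2 : ContDiff ℂ ω
      (fun w : Fin n → ℂ => (i.insertNth (1 : ℂ) w : Fin (n + 1) → ℂ)) := by
    refine contDiff_pi.2 fun l => Fin.succAboveCases i ?_ (fun j => ?_) l
    · simpa using contDiff_const
    · simpa using contDiff_apply ℂ ℂ j
  refine (h2.contMDiff.comp_contMDiffOn h1).congr fun p hp => ?_
  funext l
  refine Fin.succAboveCases i ?_ (fun j => ?_) l
  · simp [normCoord, inv_mul_cancel₀ (show p.rep i ≠ 0 from hp)]
  · simp [normCoord, affineChart, affineCoord, div_eq_inv_mul]

lemma contMDiffAt_normCoord {i : Fin (n + 1)} {p : CPn n} (hp : p.rep i ≠ 0) :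
    ContMDiffAt 𝓘(ℂ, Fin n → ℂ) 𝓘(ℂ, Fin (n + 1) → ℂ) ω (normCoord i) p :=
  (contMDiffOn_normCoord i).contMDiffAt ((isOpen_coord_ne_zero i).mem_nhds hp)

lemma contMDiffAt_proj {v : Fin (n + 1) → ℂ} (hv : v ≠ 0) :
    ContMDiffAt 𝓘(ℂ, Fin (n + 1) → ℂ) 𝓘(ℂ, Fin n → ℂ) ω proj v := by
  obtain ⟨i, hi⟩ : ∃ i, v i ≠ 0 := by
    by_contra! h
    exact hv (funext h)
  have h1 := contMDiffOn_symm_of_mem_maximalAtlas (affineChart_mem_maximalAtlas (n := n) i)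
  have h2 : ContDiffAt ℂ ω
      (fun (v : Fin (n + 1) → ℂ) (j : Fin n) => v (i.succAbove j) / v i) v :=
    contDiffAt_pi.2 fun j => ContDiffAt.div (contDiff_apply ℂ ℂ _).contDiffAt
      (contDiff_apply ℂ ℂ _).contDiffAt hi
  have h3 := ContMDiffAt.comp v
    (h1.contMDiffAt ((affineChart i).open_target.mem_nhds (mem_univ _))) h2.contMDiffAt
  refine h3.congr_of_eventuallyEq ?_
  filter_upwards [(isOpen_ne_fun (continuous_apply i) continuous_const).mem_nhds hi] with w hw
  have hw0 : w ≠ 0 := fun h => hw (by simp [h])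
  have := ofAffine_affineCoord i (proj w) ((rep_proj_ne_zero_iff hw0 i).2 hw)
  rw [← this, proj_of_ne_zero hw0, affineCoord_mk]
  rfl

lemma mdifferentiableAt_proj {v : Fin (n + 1) → ℂ} (hv : v ≠ 0) :
    MDifferentiableAt 𝓘(ℂ, Fin (n + 1) → ℂ) 𝓘(ℂ, Fin n → ℂ) proj v :=
  (contMDiffAt_proj hv).mdifferentiableAt (by simp)

/-- The differential at `z` of the projection to projective space, as a linear map between the
model spaces. -/
def tangentProj (z : Fin (n + 1) → ℂ) : (Fin (n + 1) → ℂ) →L[ℂ] (Fin n → ℂ) :=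
  mfderiv 𝓘(ℂ, Fin (n + 1) → ℂ) 𝓘(ℂ, Fin n → ℂ) proj z

lemma velocity_curve {f : ℂ → CPn n} {H : ℂ → Fin (n + 1) → ℂ} {z H' : Fin (n + 1) → ℂ}
    (hH : HasDerivAt H H' 0) (h0 : H 0 = z) (hz : z ≠ 0) (hf : ∀ᶠ t in 𝓝 0, f t = proj (H t)) :
    velocity (Fin n → ℂ) f = tangentProj z H' := by
  subst h0
  rw [velocity_congr (γ' := proj ∘ H) hf, velocity_comp rfl (mdifferentiableAt_proj hz)
    hH.differentiableAt.mdifferentiableAt, velocity_eq_deriv, hH.deriv]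
  rfl

lemma tangentProj_self {z : Fin (n + 1) → ℂ} (hz : z ≠ 0) : tangentProj z z = 0 := by
  have hH : HasDerivAt (fun t : ℂ => (1 + t) • z) ((1 : ℂ) • z) 0 :=
    ((hasDerivAt_id (0 : ℂ)).const_add 1).smul_const z
  have h := velocity_curve (f := fun _ => proj z) hH (by simp) hz ?_
  · rw [one_smul] at h
    rw [← h, velocity, mfderiv_const]
    rfl
  · have : ∀ᶠ t : ℂ in 𝓝 0, 1 + t ≠ 0 :=
      (continuous_const.add continuous_id).continuousAt.eventually_ne (by simp)
    filter_upwards [this] with t ht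
    rw [proj_smul ht hz]

/-- The kernel of the differential at `z` of the projection to projective space is the
line `ℂ z`. -/
lemma exists_eq_smul_of_tangentProj_eq_zero {z w : Fin (n + 1) → ℂ} (hz : z ≠ 0)
    (h : tangentProj z w = 0) : ∃ c : ℂ, w = c • z := by
  obtain ⟨i, hi⟩ : ∃ i, z i ≠ 0 := by
    by_contra! h
    exact hz (funext h)
  refine ⟨w i / z i, ?_⟩
  -- Differentiate `v ↦ v / v_i`, which factors through the projection.
  have hN : MDifferentiableAt 𝓘(ℂ, Fin n → ℂ) 𝓘(ℂ, Fin (n + 1) → ℂ) (normCoord i) (proj z) :=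
    (contMDiffAt_normCoord ((rep_proj_ne_zero_iff hz i).2 hi)).mdifferentiableAt (by simp)
  have h1 := mfderiv_comp z hN (mdifferentiableAt_proj hz)
  have h2 : HasDerivAt (fun t : ℂ => ((z + t • w) i)⁻¹ • (z + t • w))
      ((z i)⁻¹ • w + (-(w i) / (z i) ^ 2) • z) 0 := by
    have ha : HasDerivAt (fun t : ℂ => z + t • w) ((1 : ℂ) • w) 0 :=
      ((hasDerivAt_id (0 : ℂ)).smul_const w).const_add z
    have hb : HasDerivAt (fun t : ℂ => (z + t • w) i) (w i) 0 := by
      simpa using (hasDerivAt_pi.1 ha) i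
    have := (hb.inv (by simpa using hi)).smul ha
    simpa [Pi.smul_def', Pi.inv_def] using this
  have h3 : HasDerivAt (normCoord i ∘ proj ∘ fun t : ℂ => z + t • w)
      ((z i)⁻¹ • w + (-(w i) / (z i) ^ 2) • z) 0 := by
    refine h2.congr_of_eventuallyEq ?_
    have : ∀ᶠ t : ℂ in 𝓝 0, (z + t • w) i ≠ 0 := by
      have hc : ContinuousAt (fun t : ℂ => (z + t • w) i) 0 := by fun_prop
      exact hc.eventually_ne (by simpa using hi)
    filter_upwards [this] with t ht
    exact normCoord_proj i ht
  have h4 : DifferentiableAt ℂ (normCoord i ∘ proj) z :=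
    mdifferentiableAt_iff_differentiableAt.1 (hN.comp z (mdifferentiableAt_proj hz))
  have h5 : HasDerivAt (fun t : ℂ => z + t • w) w 0 := by
    simpa using ((hasDerivAt_id (0 : ℂ)).smul_const w).const_add z
  have h6 := HasFDerivAt.comp_hasDerivAt (0 : ℂ) (f := fun t : ℂ => z + t • w)
    (l := normCoord i ∘ proj) (l' := fderiv ℂ (normCoord i ∘ proj) z)
    (by simpa only [zero_smul, add_zero] using h4.hasFDerivAt) h5
  have h7 := h3.unique h6
  have h8 : (fderiv ℂ (normCoord i ∘ proj) z) w = 0 := by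
    rw [mfderiv_eq_fderiv] at h1
    refine (congrArg (fun L : (Fin (n + 1) → ℂ) →L[ℂ] (Fin (n + 1) → ℂ) => L w) h1).trans ?_
    change differential _ _ (normCoord i) (proj z) (tangentProj z w) = 0
    rw [h, map_zero]
  rw [h8] at h7
  have h9 : w = z i • ((z i)⁻¹ • w) := by rw [smul_smul, mul_inv_cancel₀ hi, one_smul]
  rw [h9, eq_neg_of_add_eq_zero_left h7]
  simp only [smul_smul, ← neg_smul, Pi.smul_apply, smul_eq_mul]
  congr 1
  field_simp

end CPn

/-! ### Immersions -/

section Immersion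

variable {E F : Type*} [NormedAddCommGroup E] [NormedSpace ℂ E] [NormedAddCommGroup F]
  [NormedSpace ℂ F] {M N : Type*} [TopologicalSpace M] [ChartedSpace E M]
  [TopologicalSpace N] [ChartedSpace F N]

/-- An immersion has injective differential, because it has a smooth local left inverse. -/
lemma Manifold.IsImmersion.differential_injective {f : M → N} [IsManifold 𝓘(ℂ, E) ω M]
    (hf : IsImmersion 𝓘(ℂ, E) 𝓘(ℂ, F) ω f) (x : M) :
    Function.Injective (differential E F f x) := by
  have h := hf.isImmersionAt x
  let r : N → M := fun p => h.domChart.symm (h.equiv.symm (h.codChart p)).1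
  have hchart : ∀ q ∈ h.domChart.source, h.codChart (f q) = h.equiv (h.domChart q, 0) := by
    intro q hq
    have h0 : h.domChart q ∈ (h.domChart.extend 𝓘(ℂ, E)).target := by
      simpa using h.domChart.map_source hq
    simpa [h.domChart.left_inv hq] using h.writtenInCharts h0
  have hrf : ∀ q ∈ h.domChart.source, r (f q) = q := by
    intro q hq
    simp [r, hchart q hq, h.domChart.left_inv hq]
  have hx := h.mem_domChart_source
  have hr : MDifferentiableAt 𝓘(ℂ, F) 𝓘(ℂ, E) r (f x) := by
    have h1 := (contMDiffAt_of_mem_maximalAtlas h.codChart_mem_maximalAtlas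
      h.mem_codChart_source).mdifferentiableAt (by simp)
    have h2 : (h.equiv.symm (h.codChart (f x))).1 = h.domChart x := by simp [hchart x hx]
    have h3 : MDifferentiableAt 𝓘(ℂ, E) 𝓘(ℂ, E) h.domChart.symm
        (h.equiv.symm (h.codChart (f x))).1 := by
      rw [h2]
      exact (contMDiffAt_symm_of_mem_maximalAtlas h.domChart_mem_maximalAtlas
        (h.domChart.map_source hx)).mdifferentiableAt (by simp)
    have h4 : MDifferentiableAt 𝓘(ℂ, F) 𝓘(ℂ, E) (fun v : F => (h.equiv.symm v).1)
        (h.codChart (f x)) := by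
      apply DifferentiableAt.mdifferentiableAt
      fun_prop
    exact h3.comp (f x) (h4.comp (f x) h1)
  have hid : r ∘ f =ᶠ[𝓝 x] id :=
    Filter.eventuallyEq_of_mem (h.domChart.open_source.mem_nhds hx) hrf
  have h5 := mfderiv_comp x hr (h.contMDiffAt.mdifferentiableAt (by simp))
  have h6 := hid.mfderiv_eq (I := 𝓘(ℂ, E)) (I' := 𝓘(ℂ, E))
  rw [h5, mfderiv_id] at h6
  intro v w hvw
  have h7 := fun u : E => congrArg (fun L : E →L[ℂ] E => L u) h6
  rw [← show _ = v from h7 v, ← show _ = w from h7 w]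
  exact congrArg (fun u : F => (mfderiv 𝓘(ℂ, F) 𝓘(ℂ, E) r (f x) : F →L[ℂ] E) u) hvw

end Immersion

/-! ### Powers of the tautological line bundle, and sprays defined on them -/

section LineBundle

variable {n d : ℕ} {X : Type*} [TopologicalSpace X] [ChartedSpace (Fin d → ℂ) X]

/-- The pullback by `κ : X → ℂℙ^n` of the `e`-th power of the tautological line bundle. The fibre at
`x` consists of the numbers `τ` attached to homogeneous coordinates `z` of `κ x`, where `(z, τ)` is
identified with `(c z, c⁻ᵉ τ)`; over `{Z_i ≠ 0}` it is trivialized by the coordinate `z_i ^ e τ`. -/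
def tautPowerCore (κ : X → CPn n) (hκ : ContMDiff 𝓘(ℂ, Fin d → ℂ) 𝓘(ℂ, Fin n → ℂ) ω κ) (e : ℕ) :
    VectorBundleCore ℂ X (Fin 1 → ℂ) (Fin (n + 1)) where
  baseSet i := {x | (κ x).rep i ≠ 0}
  isOpen_baseSet i := (CPn.isOpen_coord_ne_zero i).preimage hκ.continuous
  indexAt x := (CPn.exists_rep_ne_zero (κ x)).choose
  mem_baseSet_at x := (CPn.exists_rep_ne_zero (κ x)).choose_spec
  coordChange i j x := (CPn.normCoord i (κ x) j) ^ e • ContinuousLinearMap.id ℂ (Fin 1 → ℂ)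
  coordChange_self i x hx v := by
    simp [CPn.normCoord, inv_mul_cancel₀ (show (κ x).rep i ≠ 0 from hx)]
  continuousOn_coordChange i j := by
    have h : ContinuousOn (fun x => CPn.normCoord i (κ x) j)
        ({x | (κ x).rep i ≠ 0} ∩ {x | (κ x).rep j ≠ 0}) :=
      ((continuous_apply j).comp_continuousOn (CPn.contMDiffOn_normCoord i).continuousOn).comp
        hκ.continuous.continuousOn (fun x hx => hx.1)
    exact (h.pow e).smul continuousOn_const
  coordChange_comp i j k x hx v := by
    have hi : (κ x).rep i ≠ 0 := hx.1.1
    have hj : (κ x).rep j ≠ 0 := hx.1.2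
    simp only [CPn.normCoord, Pi.smul_apply, smul_eq_mul, _root_.smul_apply,
      ContinuousLinearMap.id_apply, smul_smul, ← mul_pow]
    congr 2
    field_simp

variable (κ : X → CPn n) (hκ : ContMDiff 𝓘(ℂ, Fin d → ℂ) 𝓘(ℂ, Fin n → ℂ) ω κ) (e : ℕ)

instance : (tautPowerCore κ hκ e).IsContMDiff 𝓘(ℂ, Fin d → ℂ) ω where
  contMDiffOn_coordChange i j := by
    have h1 : ContMDiffOn 𝓘(ℂ, Fin d → ℂ) 𝓘(ℂ, Fin (n + 1) → ℂ) ω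
        (fun x => CPn.normCoord i (κ x)) {x | (κ x).rep i ≠ 0} :=
      (CPn.contMDiffOn_normCoord i).comp hκ.contMDiffOn (fun x hx => hx)
    have h2 : ContDiff ℂ ω (fun v : Fin (n + 1) → ℂ =>
        (v j) ^ e • ContinuousLinearMap.id ℂ (Fin 1 → ℂ)) :=
      ((contDiff_apply ℂ ℂ j).pow e).smul contDiff_const
    exact (h2.contMDiff.comp_contMDiffOn h1).mono inter_subset_left

/-- A map on the total space is holomorphic if it is so in the coordinates `z_i ^ e τ` of the
fibres. -/
lemma contMDiff_lineSpray (g : X → ℂ → X)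
    (hg : ∀ i, ∀ p : X × ℂ, (κ p.1).rep i ≠ 0 →
      ContMDiffAt (𝓘(ℂ, Fin d → ℂ).prod 𝓘(ℂ, ℂ)) 𝓘(ℂ, Fin d → ℂ) ω
        (fun q : X × ℂ => g q.1 (((κ q.1).rep i ^ e)⁻¹ * q.2)) p) :
    ContMDiff (𝓘(ℂ, Fin d → ℂ).prod 𝓘(ℂ, Fin 1 → ℂ)) 𝓘(ℂ, Fin d → ℂ) ω
      (fun q : TotalSpace (Fin 1 → ℂ) (tautPowerCore κ hκ e).Fiber => g q.1
        (((κ q.1).rep ((tautPowerCore κ hκ e).indexAt q.1) ^ e)⁻¹ *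
          (show Fin 1 → ℂ from q.2) 0)) := by
  set Z := tautPowerCore κ hκ e with hZ
  intro p
  have hp : (κ p.1).rep (Z.indexAt p.1) ≠ 0 := Z.mem_baseSet_at p.1
  have h1 := (Bundle.contMDiffAt_totalSpace (n := ω) (IB := 𝓘(ℂ, Fin d → ℂ))
    (F := Fin 1 → ℂ) (E := Z.Fiber) (f := id) (x₀ := p)).1 contMDiffAt_id
  have h2 : ContMDiffAt (𝓘(ℂ, Fin d → ℂ).prod 𝓘(ℂ, Fin 1 → ℂ))
      (𝓘(ℂ, Fin d → ℂ).prod 𝓘(ℂ, ℂ)) ω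
      (fun q : TotalSpace (Fin 1 → ℂ) Z.Fiber =>
        (q.1, (trivializationAt (Fin 1 → ℂ) Z.Fiber p.1 q).2 0)) p := by
    refine h1.1.prodMk ?_
    exact (contDiff_apply ℂ ℂ (0 : Fin 1)).contMDiff.contMDiffAt.comp p h1.2
  have h3 := ContMDiffAt.comp p (hg (Z.indexAt p.1)
    (p.1, (trivializationAt (Fin 1 → ℂ) Z.Fiber p.1 p).2 0) hp) h2
  refine h3.congr_of_eventuallyEq ?_
  have h4 : ∀ᶠ q : TotalSpace (Fin 1 → ℂ) Z.Fiber in 𝓝 p,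
      (κ q.1).rep (Z.indexAt p.1) ≠ 0 :=
    (FiberBundle.continuous_proj (Fin 1 → ℂ) Z.Fiber).continuousAt.eventually
      ((Z.isOpen_baseSet (Z.indexAt p.1)).mem_nhds hp)
  filter_upwards [h4] with q hq
  have hq' : (κ q.1).rep (Z.indexAt q.1) ≠ 0 := Z.mem_baseSet_at q.1
  change g q.1 _ = g q.1 (_ * ((CPn.normCoord (Z.indexAt q.1) (κ q.1) (Z.indexAt p.1)) ^ e *
    (show Fin 1 → ℂ from q.2) 0))
  congr 1
  simp only [CPn.normCoord, Pi.smul_apply, smul_eq_mul, mul_pow, inv_pow]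
  field_simp

/-- A family of curves `g x : ℂ → X` with `g x 0 = x` is a spray on the `e`-th power of the
tautological line bundle, if it is holomorphic in the local trivializations of this bundle. -/
def lineSpray (g : X → ℂ → X) (hg0 : ∀ x, g x 0 = x)
    (hg : ∀ i, ∀ p : X × ℂ, (κ p.1).rep i ≠ 0 →
      ContMDiffAt (𝓘(ℂ, Fin d → ℂ).prod 𝓘(ℂ, ℂ)) 𝓘(ℂ, Fin d → ℂ) ω
        (fun q : X × ℂ => g q.1 (((κ q.1).rep i ^ e)⁻¹ * q.2)) p) :
    HolomorphicSpray d X where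
  rank := 1
  Fib := (tautPowerCore κ hκ e).Fiber
  holomorphicBundle := inferInstance
  toFun q := g q.1
    (((κ q.1).rep ((tautPowerCore κ hκ e).indexAt q.1) ^ e)⁻¹ * (show Fin 1 → ℂ from q.2) 0)
  map_zero x := by
    change g x (_ * (0 : ℂ)) = x
    rw [mul_zero, hg0]
  holomorphic := contMDiff_lineSpray κ hκ e g hg

/-- The velocities of the curves of which a spray on a line bundle consists are vertical
derivatives of the spray. -/
lemma velocity_mem_verticalImage_lineSpray (g : X → ℂ → X) (hg0 : ∀ x, g x 0 = x)
    (hg : ∀ i, ∀ p : X × ℂ, (κ p.1).rep i ≠ 0 →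
      ContMDiffAt (𝓘(ℂ, Fin d → ℂ).prod 𝓘(ℂ, ℂ)) 𝓘(ℂ, Fin d → ℂ) ω
        (fun q : X × ℂ => g q.1 (((κ q.1).rep i ^ e)⁻¹ * q.2)) p) (x : X) :
    velocity (Fin d → ℂ) (g x) ∈ (lineSpray κ hκ e g hg0 hg).verticalImage
      (lineSpray κ hκ e g hg0 hg).toFun x := by
  set Z := tautPowerCore κ hκ e with hZ
  set i := Z.indexAt x with hi
  have hx : (κ x).rep i ≠ 0 := Z.mem_baseSet_at x
  have hfun : (fun v : Fin 1 → ℂ => (lineSpray κ hκ e g hg0 hg).toFun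
      ⟨x, (trivializationAt (Fin 1 → ℂ) Z.Fiber x).symm x v⟩) =
      fun v => g x (((κ x).rep i ^ e)⁻¹ * v 0) := by
    funext v
    have h1 : (trivializationAt (Fin 1 → ℂ) Z.Fiber x).symm x v = Z.coordChange i i x v :=
      Z.localTriv_symm_apply i (Z.mem_baseSet_at x) v
    rw [h1, Z.coordChange_self i x hx]
    rfl
  have hdiff : MDifferentiableAt 𝓘(ℂ, Fin 1 → ℂ) 𝓘(ℂ, Fin d → ℂ)
      (fun v : Fin 1 → ℂ => g x (((κ x).rep i ^ e)⁻¹ * v 0)) 0 := by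
    have h1 : ContMDiffAt 𝓘(ℂ, Fin 1 → ℂ) (𝓘(ℂ, Fin d → ℂ).prod 𝓘(ℂ, ℂ)) ω
        (fun v : Fin 1 → ℂ => (x, v 0)) 0 :=
      contMDiffAt_const.prodMk (contDiff_apply ℂ ℂ (0 : Fin 1)).contMDiff.contMDiffAt
    exact ((hg i (x, (0 : Fin 1 → ℂ) 0) hx).comp (0 : Fin 1 → ℂ) h1).mdifferentiableAt (by simp)
  have hcurve : g x = (fun v : Fin 1 → ℂ => g x (((κ x).rep i ^ e)⁻¹ * v 0)) ∘
      fun t : ℂ => fun _ => (κ x).rep i ^ e * t := by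
    funext t
    simp only [Function.comp_apply]
    rw [← mul_assoc, inv_mul_cancel₀ (pow_ne_zero e hx), one_mul]
  have hv := velocity_comp (γ := fun t : ℂ => fun _ : Fin 1 => (κ x).rep i ^ e * t)
    (x := (0 : Fin 1 → ℂ)) (by ext; simp) hdiff
    (DifferentiableAt.mdifferentiableAt (by fun_prop))
  rw [← hcurve] at hv
  rw [hv]
  exact ⟨(velocity (Fin 1 → ℂ) fun (t : ℂ) (_ : Fin 1) => (κ x).rep i ^ e * t : Fin 1 → ℂ),
    congrArg (fun φ : (Fin 1 → ℂ) → X => differential (Fin 1 → ℂ) (Fin d → ℂ) φ 0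
      (velocity (Fin 1 → ℂ) fun (t : ℂ) (_ : Fin 1) => (κ x).rep i ^ e * t)) hfun⟩

end LineBundle

/-! ### Tuples of polynomials in homogeneous coordinates and a time variable -/

section PolyEval

variable {n : ℕ}

/-- The vector of values at `z ∈ ℂ^(n+1)` and `t ∈ ℂ` of a tuple of polynomials in `t` whose
coefficients are polynomials in `z`. -/
def polyEval (P : Fin (n + 1) → Polynomial (MvPolynomial (Fin (n + 1)) ℂ))
    (z : Fin (n + 1) → ℂ) (t : ℂ) : Fin (n + 1) → ℂ :=
  fun l => (P l).eval₂ (MvPolynomial.eval z) t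

lemma polyEval_zero (P : Fin (n + 1) → Polynomial (MvPolynomial (Fin (n + 1)) ℂ))
    (z : Fin (n + 1) → ℂ) (l : Fin (n + 1)) :
    polyEval P z 0 l = MvPolynomial.eval z ((P l).coeff 0) := by
  simp [polyEval, Polynomial.eval₂_at_zero]

lemma polyEval_eq_add (P : Fin (n + 1) → Polynomial (MvPolynomial (Fin (n + 1)) ℂ))
    (z : Fin (n + 1) → ℂ) (t : ℂ) :
    polyEval P z t = polyEval P z 0 + t • polyEval (fun l => (P l).divX) z t := by
  funext l
  rw [Pi.add_apply, polyEval_zero]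
  simp only [polyEval, Pi.smul_apply, smul_eq_mul]
  conv_lhs => rw [← Polynomial.divX_mul_X_add (P l)]
  rw [Polynomial.eval₂_add, Polynomial.eval₂_mul, Polynomial.eval₂_X, Polynomial.eval₂_C]
  ring

lemma contDiff_mvPolynomial_eval (p : MvPolynomial (Fin (n + 1)) ℂ) :
    ContDiff ℂ ω (fun z : Fin (n + 1) → ℂ => MvPolynomial.eval z p) :=
  (AnalyticOnNhd.eval_mvPolynomial p).contDiff

lemma contDiff_polyEval (P : Fin (n + 1) → Polynomial (MvPolynomial (Fin (n + 1)) ℂ)) :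
    ContDiff ℂ ω (fun p : (Fin (n + 1) → ℂ) × ℂ => polyEval P p.1 p.2) := by
  refine contDiff_pi.2 fun l => ?_
  simp only [polyEval, Polynomial.eval₂_eq_sum_range]
  exact ContDiff.sum fun k _ =>
    ((contDiff_mvPolynomial_eval _).comp contDiff_fst).mul (contDiff_snd.pow k)

lemma hasDerivAt_add_smul_polyEval
    (P : Fin (n + 1) → Polynomial (MvPolynomial (Fin (n + 1)) ℂ)) (z : Fin (n + 1) → ℂ) (a b : ℂ) :
    HasDerivAt (fun t : ℂ => z + (a * t) • polyEval P z (b * t)) (a • polyEval P z 0) 0 := by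
  have h1 : ContDiff ℂ ω (fun t : ℂ => polyEval P z (b * t)) :=
    ContDiff.comp (g := fun p : (Fin (n + 1) → ℂ) × ℂ => polyEval P p.1 p.2)
      (f := fun t : ℂ => (z, b * t)) (contDiff_polyEval P) (by fun_prop)
  obtain ⟨φ', h2⟩ : ∃ φ', HasDerivAt (fun t : ℂ => polyEval P z (b * t)) φ' 0 :=
    ⟨_, (h1.contDiffAt.differentiableAt (by simp)).hasDerivAt⟩
  have h3 : HasDerivAt (fun t : ℂ => a * t) a 0 := by
    simpa using (hasDerivAt_id (0 : ℂ)).const_mul a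
  have h4 : HasDerivAt (fun t : ℂ => z + (a * t) • polyEval P z (b * t))
      ((a * 0) • φ' + a • polyEval P z (b * 0)) 0 := (h3.smul h2).const_add z
  simp only [mul_zero, zero_smul, zero_add] at h4
  exact h4

/-- Euler's scaling identity for the values of a weighted homogeneous polynomial. -/
lemma eval_weighted_smul {σ : Type*} {w : σ → ℕ} {m : ℕ} {p : MvPolynomial σ ℂ}
    (hp : p.IsWeightedHomogeneous w m) (c : ℂ) (x : σ → ℂ) :
    MvPolynomial.eval (fun i => c ^ w i * x i) p = c ^ m * MvPolynomial.eval x p := by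
  rw [MvPolynomial.eval_eq, MvPolynomial.eval_eq, Finset.mul_sum]
  refine Finset.sum_congr rfl fun s hs => ?_
  have hw : Finsupp.weight w s = m := hp (MvPolynomial.mem_support_iff.1 hs)
  have h : ∏ i ∈ s.support, (c ^ w i) ^ s i = c ^ m := by
    rw [← hw, Finsupp.weight_apply, Finsupp.sum, ← Finset.prod_pow_eq_pow_sum]
    exact Finset.prod_congr rfl fun i _ => by rw [← pow_mul, smul_eq_mul, mul_comm]
  simp only [mul_pow, Finset.prod_mul_distrib]
  rw [h]
  ring

lemma eval_smul_of_isHomogeneous {m : ℕ} {p : MvPolynomial (Fin (n + 1)) ℂ}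
    (hp : p.IsHomogeneous m) (c : ℂ) (z : Fin (n + 1) → ℂ) :
    MvPolynomial.eval (c • z) p = c ^ m * MvPolynomial.eval z p := by
  rw [← eval_weighted_smul hp c z]
  congr 2
  funext i
  simp

end PolyEval

/-! ### Extending regular families of curves to sprays -/

section RegularCurves

variable {n : ℕ} {X : Type*}

/-- A family of curves `γ x : ℂ → X` with `γ x 0 = x`, where `x` ranges over the set where `K ≠ 0`,
which is regular: Zariski-locally it is given in homogeneous coordinates by a tuple of polynomials
in `(z, t)` which is homogeneous in `z`. -/
structure IsRegularCurves (κ : X → CPn n) (K : MvPolynomial (Fin (n + 1)) ℂ)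
    (γ : X → ℂ → X) : Prop where
  zero : ∀ x, MvPolynomial.eval (κ x).rep K ≠ 0 → γ x 0 = x
  regular : ∀ x, MvPolynomial.eval (κ x).rep K ≠ 0 → ∀ t : ℂ,
    ∃ (m : ℕ) (P : Fin (n + 1) → Polynomial (MvPolynomial (Fin (n + 1)) ℂ)),
      (∀ (c : ℂ) z s, polyEval P (c • z) s = c ^ m • polyEval P z s) ∧
      polyEval P (κ x).rep t ≠ 0 ∧
      ∀ x', MvPolynomial.eval (κ x').rep K ≠ 0 → ∀ t', polyEval P (κ x').rep t' ≠ 0 →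
        κ (γ x' t') = CPn.proj (polyEval P (κ x').rep t')

variable {κ : X → CPn n}

/-- The curves of a regular family through the points where `K ≠ 0`, run at the speed
`c z`, are given near time `0` and near the zeros of `c` by a single tuple `F (z, t)`, which is
`z` at the zeros of `c`. -/
lemma IsRegularCurves.exists_extension {K : MvPolynomial (Fin (n + 1)) ℂ} {k : ℕ}
    (hK : K.IsHomogeneous k) {γ : X → ℂ → X}
    (hγ : IsRegularCurves κ K γ) {y : X} (hy : MvPolynomial.eval (κ y).rep K ≠ 0) :
    ∃ (e : ℕ) (c : MvPolynomial (Fin (n + 1)) ℂ) (W : Fin (n + 1) → MvPolynomial (Fin (n + 1)) ℂ)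
      (F : (Fin (n + 1) → ℂ) × ℂ → Fin (n + 1) → ℂ),
      (∀ (a : ℂ) z, MvPolynomial.eval (a • z) c = a ^ e * MvPolynomial.eval z c) ∧
      MvPolynomial.eval (κ y).rep c ≠ 0 ∧
      (∀ x, MvPolynomial.eval (κ x).rep c ≠ 0 → MvPolynomial.eval (κ x).rep K ≠ 0) ∧
      ContDiff ℂ ω F ∧ (∀ z, F (z, 0) = z) ∧
      (∀ z, HasDerivAt (fun t => F (z, t)) (fun l => MvPolynomial.eval z (W l)) 0) ∧
      (∀ z t, MvPolynomial.eval z c = 0 → F (z, t) = z) ∧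
      ∀ x (a : ℂ), a ≠ 0 → ∀ t, MvPolynomial.eval (κ x).rep c ≠ 0 → F (a • (κ x).rep, t) ≠ 0 →
        κ (γ x (MvPolynomial.eval (a • (κ x).rep) c * t)) = CPn.proj (F (a • (κ x).rep, t)) := by
  obtain ⟨m, P, hPhom, hPy, hP⟩ := hγ.regular y hy 0
  obtain ⟨i, hi⟩ := CPn.exists_rep_ne_zero (κ y)
  set P₁ : Fin (n + 1) → Polynomial (MvPolynomial (Fin (n + 1)) ℂ) := fun l => (P l).divX with hP₁
  set D : MvPolynomial (Fin (n + 1)) ℂ := (P i).coeff 0 with hD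
  set B : MvPolynomial (Fin (n + 1)) ℂ := MvPolynomial.X i * D * K with hB
  set c : MvPolynomial (Fin (n + 1)) ℂ := B * D with hc
  set e : ℕ := 1 + m + k + m with he
  let F : (Fin (n + 1) → ℂ) × ℂ → Fin (n + 1) → ℂ := fun p =>
    p.1 + (p.1 i * MvPolynomial.eval p.1 B * p.2) • polyEval P₁ p.1 (MvPolynomial.eval p.1 c * p.2)
  have hev : ∀ z, MvPolynomial.eval z c
      = z i * MvPolynomial.eval z D * MvPolynomial.eval z K * MvPolynomial.eval z D := by
    intro z; simp [hc, hB]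
  have hDhom : ∀ (a : ℂ) z, MvPolynomial.eval (a • z) D = a ^ m * MvPolynomial.eval z D := by
    intro a z
    have := congrFun (hPhom a z 0) i
    rwa [Pi.smul_apply, polyEval_zero, polyEval_zero] at this
  have hKhom := eval_smul_of_isHomogeneous hK
  have hchom : ∀ (a : ℂ) z, MvPolynomial.eval (a • z) c = a ^ e * MvPolynomial.eval z c := by
    intro a z
    rw [hev, hev, hDhom, hKhom, he, Pi.smul_apply, smul_eq_mul]
    ring
  -- At time `0` the tuple is proportional to `z`, since `γ x 0 = x`.
  have hprop : ∀ x, MvPolynomial.eval (κ x).rep K ≠ 0 → ∀ a : ℂ,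
      (a • (κ x).rep) i • polyEval P (a • (κ x).rep) 0
        = MvPolynomial.eval (a • (κ x).rep) D • (a • (κ x).rep) := by
    intro x hx a
    rw [hPhom, hDhom]
    have hD0 : MvPolynomial.eval (κ x).rep D = polyEval P (κ x).rep 0 i :=
      (polyEval_zero _ _ _).symm
    rw [hD0]
    by_cases h0 : polyEval P (κ x).rep 0 = 0
    · simp [h0]
    · have h1 := hP x hx 0 h0
      rw [hγ.zero x hx] at h1
      obtain ⟨b, -, hb⟩ := CPn.exists_smul_of_proj_eq (κ x).rep_nonzero h0
        ((CPn.proj_rep _).trans h1)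
      funext l
      have hbi := congrFun hb i
      have hbl := congrFun hb l
      simp only [Pi.smul_apply, smul_eq_mul] at hbi hbl ⊢
      rw [hbi, hbl]
      ring
  have hfactor : ∀ x, MvPolynomial.eval (κ x).rep K ≠ 0 → ∀ a t : ℂ,
      (a • (κ x).rep) i • polyEval P (a • (κ x).rep) (MvPolynomial.eval (a • (κ x).rep) c * t)
        = MvPolynomial.eval (a • (κ x).rep) D • F (a • (κ x).rep, t) := by
    intro x hx a t
    rw [polyEval_eq_add, smul_add, hprop x hx a]
    simp only [F, smul_add, smul_smul]
    congr 2
    simp only [hc, map_mul]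
    ring
  have hne : ∀ x, MvPolynomial.eval (κ x).rep c ≠ 0 → MvPolynomial.eval (κ x).rep K ≠ 0 := by
    intro x hx h
    exact hx (by rw [hev, h]; ring)
  have hFc : ∀ z t, MvPolynomial.eval z c = 0 → F (z, t) = z := by
    intro z t hz
    have : MvPolynomial.eval z B = 0 := by
      have h1 : MvPolynomial.eval z B * MvPolynomial.eval z D = 0 := by rw [← map_mul]; exact hz
      rcases mul_eq_zero.1 h1 with h | h
      · exact h
      · simp [hB, h]
    simp [F, this]
  have hFsmooth : ContDiff ℂ ω F := by
    have hpi : ContDiff ℂ ω (fun p : (Fin (n + 1) → ℂ) × ℂ => p.1 i) :=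
      (contDiff_apply ℂ ℂ i).comp contDiff_fst
    have h1 : ContDiff ℂ ω (fun p : (Fin (n + 1) → ℂ) × ℂ =>
        (p.1, MvPolynomial.eval p.1 c * p.2)) :=
      contDiff_fst.prodMk (((contDiff_mvPolynomial_eval c).comp contDiff_fst).mul contDiff_snd)
    exact contDiff_fst.add (((hpi.mul ((contDiff_mvPolynomial_eval B).comp contDiff_fst)).mul
      contDiff_snd).smul ((contDiff_polyEval P₁).comp h1))
  have hDy : MvPolynomial.eval (κ y).rep D ≠ 0 := by
    intro h
    have h1 := hprop y hy 1
    rw [one_smul, h, zero_smul] at h1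
    exact smul_ne_zero hi hPy h1
  have hcy : MvPolynomial.eval (κ y).rep c ≠ 0 := by
    rw [hev]
    exact mul_ne_zero (mul_ne_zero (mul_ne_zero hi hDy) hy) hDy
  refine ⟨e, c, fun l => MvPolynomial.X i * B * (P₁ l).coeff 0, F, hchom, hcy, hne, hFsmooth,
    fun z => by simp [F], fun z => ?_, hFc, ?_⟩
  · have h0 : HasDerivAt (fun t => F (z, t))
        ((z i * MvPolynomial.eval z B) • polyEval P₁ z 0) 0 :=
      hasDerivAt_add_smul_polyEval P₁ z (z i * MvPolynomial.eval z B) (MvPolynomial.eval z c)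
    refine h0.congr_deriv ?_
    funext l
    simp [polyEval_zero]
  · intro x a ha t h hF
    have hKx := hne x h
    have hcv : MvPolynomial.eval (a • (κ x).rep) c ≠ 0 := by
      rw [hchom]; exact mul_ne_zero (pow_ne_zero _ ha) h
    have hv : (a • (κ x).rep) i ≠ 0 := fun h0 => hcv (by rw [hev, h0]; ring)
    have hDv : MvPolynomial.eval (a • (κ x).rep) D ≠ 0 := fun h0 => hcv (by rw [hev, h0]; ring)
    have hfac := hfactor x hKx a t
    set s := MvPolynomial.eval (a • (κ x).rep) c * t with hs
    have hP0 : polyEval P (a • (κ x).rep) s ≠ 0 := by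
      intro h0
      rw [h0, smul_zero] at hfac
      exact smul_ne_zero hDv hF hfac.symm
    have hP1 : polyEval P (κ x).rep s ≠ 0 := by
      intro h0
      exact hP0 (by rw [hPhom, h0, smul_zero])
    rw [hP x hKx s hP1, ← CPn.proj_smul (pow_ne_zero m ha) hP1, ← hPhom,
      ← CPn.proj_smul hv hP0, hfac, CPn.proj_smul hDv hF]

variable {d : ℕ} [TopologicalSpace X] [ChartedSpace (Fin d → ℂ) X]

/-- A map to projective space which is given in homogeneous coordinates by a holomorphic function
of normalized homogeneous coordinates and a time variable is holomorphic. -/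
lemma contMDiffAt_of_eq_proj (hκ : ContMDiff 𝓘(ℂ, Fin d → ℂ) 𝓘(ℂ, Fin n → ℂ) ω κ)
    {f : X × ℂ → CPn n} {i : Fin (n + 1)} {p : X × ℂ} (hp : (κ p.1).rep i ≠ 0)
    {Φ : (Fin (n + 1) → ℂ) × ℂ → Fin (n + 1) → ℂ} (hΦ : ContDiff ℂ ω Φ)
    (h0 : Φ (CPn.normCoord i (κ p.1), p.2) ≠ 0)
    (hf : ∀ᶠ q : X × ℂ in 𝓝 p, Φ (CPn.normCoord i (κ q.1), q.2) ≠ 0 →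
      f q = CPn.proj (Φ (CPn.normCoord i (κ q.1), q.2))) :
    ContMDiffAt (𝓘(ℂ, Fin d → ℂ).prod 𝓘(ℂ, ℂ)) 𝓘(ℂ, Fin n → ℂ) ω f p := by
  have h1 : ContMDiffAt (𝓘(ℂ, Fin d → ℂ).prod 𝓘(ℂ, ℂ)) 𝓘(ℂ, (Fin (n + 1) → ℂ) × ℂ) ω
      (fun q : X × ℂ => (CPn.normCoord i (κ q.1), q.2)) p :=
    (((CPn.contMDiffAt_normCoord hp).comp p.1 (hκ p.1)).comp p contMDiffAt_fst).prodMk_space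
      contMDiffAt_snd
  have h2 := hΦ.contMDiff.contMDiffAt.comp p h1
  refine ((CPn.contMDiffAt_proj h0).comp p h2).congr_of_eventuallyEq ?_
  filter_upwards [hf, h2.continuousAt.eventually_ne h0] with q hq hq0
  exact hq hq0

/-- A regular family of curves, run at a speed that vanishes outside of `{K ≠ 0}`, extends to a
spray on a line bundle. Its velocities `ζ` are given in homogeneous coordinates by polynomials
`W`. -/
theorem IsRegularCurves.exists_spray (hκ : ContMDiff 𝓘(ℂ, Fin d → ℂ) 𝓘(ℂ, Fin n → ℂ) ω κ)
    (hlift : ∀ (f : X × ℂ → X) (p : X × ℂ),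
      ContMDiffAt (𝓘(ℂ, Fin d → ℂ).prod 𝓘(ℂ, ℂ)) 𝓘(ℂ, Fin n → ℂ) ω (κ ∘ f) p →
      ContMDiffAt (𝓘(ℂ, Fin d → ℂ).prod 𝓘(ℂ, ℂ)) 𝓘(ℂ, Fin d → ℂ) ω f p)
    {K : MvPolynomial (Fin (n + 1)) ℂ} {k : ℕ} (hK : K.IsHomogeneous k) {γ : X → ℂ → X}
    (hγ : IsRegularCurves κ K γ) {y : X} (hy : MvPolynomial.eval (κ y).rep K ≠ 0) :
    ∃ (S : HolomorphicSpray d X) (ζ : X → Fin d → ℂ)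
      (W : Fin (n + 1) → MvPolynomial (Fin (n + 1)) ℂ) (a : ℂ),
      a ≠ 0 ∧ ζ y = a • velocity (Fin d → ℂ) (γ y) ∧
      ∀ x, ζ x ∈ S.verticalImage S.toFun x ∧
        differential (Fin d → ℂ) (Fin n → ℂ) κ x (ζ x) =
          CPn.tangentProj (κ x).rep (fun l => MvPolynomial.eval (κ x).rep (W l)) := by
  classical
  obtain ⟨e, c, W, F, hchom, hcy, hne, hFsmooth, hF0, hFderiv, hFc, hγF⟩ :=
    hγ.exists_extension hK hy
  -- The time `t` refers to the representative `(κ x).rep` of the homogeneous coordinates.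
  let g : X → ℂ → X := fun x t =>
    if MvPolynomial.eval (κ x).rep c = 0 then x else γ x (MvPolynomial.eval (κ x).rep c * t)
  have hg0 : ∀ x, g x 0 = x := by
    intro x
    by_cases h : MvPolynomial.eval (κ x).rep c = 0
    · simp [g, h]
    · simp only [g, h, if_false, mul_zero]
      exact hγ.zero x (hne x h)
  have hgF : ∀ x (a : ℂ), a ≠ 0 → ∀ t, F (a • (κ x).rep, t) ≠ 0 →
      κ (g x (a ^ e * t)) = CPn.proj (F (a • (κ x).rep, t)) := by
    intro x a ha t hF
    by_cases h : MvPolynomial.eval (κ x).rep c = 0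
    · rw [hFc _ _ (by rw [hchom, h, mul_zero])]
      simp only [g, h, if_true]
      rw [CPn.proj_smul ha (κ x).rep_nonzero, CPn.proj_rep]
    · have ht : MvPolynomial.eval (κ x).rep c * (a ^ e * t)
          = MvPolynomial.eval (a • (κ x).rep) c * t := by rw [hchom]; ring
      simp only [g, h, if_false]
      rw [ht]
      exact hγF x a ha t h hF
  have hg : ∀ j, ∀ p : X × ℂ, (κ p.1).rep j ≠ 0 →
      ContMDiffAt (𝓘(ℂ, Fin d → ℂ).prod 𝓘(ℂ, ℂ)) 𝓘(ℂ, Fin d → ℂ) ω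
        (fun q : X × ℂ => g q.1 (((κ q.1).rep j ^ e)⁻¹ * q.2)) p := by
    intro j p hp
    refine hlift _ p ?_
    have hopen : ∀ᶠ q : X × ℂ in 𝓝 p, (κ q.1).rep j ≠ 0 :=
      (hκ.continuous.comp continuous_fst).continuousAt.eventually
        ((CPn.isOpen_coord_ne_zero j).mem_nhds hp)
    by_cases hF : F (CPn.normCoord j (κ p.1), p.2) = 0
    · -- Here `c ≠ 0`, and `γ` is regular by assumption.
      have hcv : MvPolynomial.eval (CPn.normCoord j (κ p.1)) c ≠ 0 := by
        intro h
        rw [hFc _ _ h] at hF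
        exact CPn.normCoord_ne_zero hp hF
      have hcp : MvPolynomial.eval (κ p.1).rep c ≠ 0 := by
        intro h
        exact hcv (by rw [CPn.normCoord, hchom, h, mul_zero])
      obtain ⟨m', P', hP'hom, hP'0, hP'⟩ := hγ.regular p.1 (hne _ hcp)
        (MvPolynomial.eval (CPn.normCoord j (κ p.1)) c * p.2)
      have hΦ : ContDiff ℂ ω (fun q : (Fin (n + 1) → ℂ) × ℂ =>
          polyEval P' q.1 (MvPolynomial.eval q.1 c * q.2)) :=
        (contDiff_polyEval P').comp (contDiff_fst.prodMk
          (((contDiff_mvPolynomial_eval c).comp contDiff_fst).mul contDiff_snd))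
      refine contMDiffAt_of_eq_proj hκ hp hΦ ?_ ?_
      · change polyEval P' (CPn.normCoord j (κ p.1)) _ ≠ 0
        conv_lhs => arg 2; rw [CPn.normCoord]
        rw [hP'hom]
        exact smul_ne_zero (pow_ne_zero _ (inv_ne_zero hp)) hP'0
      · have hcnear : ∀ᶠ q : X × ℂ in 𝓝 p,
            MvPolynomial.eval (CPn.normCoord j (κ q.1)) c ≠ 0 := by
          have h1 : ContinuousAt (fun q : X × ℂ => CPn.normCoord j (κ q.1)) p :=
            ((CPn.contMDiffAt_normCoord hp).continuousAt.comp hκ.continuous.continuousAt).comp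
              continuousAt_fst
          exact ((contDiff_mvPolynomial_eval c).continuous.continuousAt.comp h1).eventually_ne hcv
        filter_upwards [hopen, hcnear] with q hq hqc hq0
        have hqc' : MvPolynomial.eval (κ q.1).rep c ≠ 0 := by
          intro h
          exact hqc (by rw [CPn.normCoord, hchom, h, mul_zero])
        have ht : MvPolynomial.eval (κ q.1).rep c * (((κ q.1).rep j ^ e)⁻¹ * q.2)
            = MvPolynomial.eval (CPn.normCoord j (κ q.1)) c * q.2 := by
          rw [CPn.normCoord, hchom, inv_pow]; ring
        simp only [Function.comp_apply, g, hqc', if_false]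
        rw [ht]
        set s := MvPolynomial.eval (CPn.normCoord j (κ q.1)) c * q.2
        have h2 : polyEval P' (CPn.normCoord j (κ q.1)) s
            = ((κ q.1).rep j)⁻¹ ^ m' • polyEval P' (κ q.1).rep s := hP'hom _ _ _
        have h3 : polyEval P' (κ q.1).rep s ≠ 0 := by
          intro h
          exact hq0 (by rw [h2, h, smul_zero])
        rw [hP' q.1 (hne _ hqc') s h3, h2, CPn.proj_smul (pow_ne_zero _ (inv_ne_zero hq)) h3]
    · -- This case covers the zeros of `c`, where `F (z, t) = z`.
      refine contMDiffAt_of_eq_proj hκ hp hFsmooth hF ?_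
      filter_upwards [hopen] with q hq hq0
      have := hgF q.1 ((κ q.1).rep j)⁻¹ (inv_ne_zero hq) q.2 hq0
      rw [inv_pow] at this
      exact this
  have hgdiff : ∀ x, MDifferentiableAt 𝓘(ℂ, ℂ) 𝓘(ℂ, Fin d → ℂ) (g x) 0 := by
    intro x
    obtain ⟨j, hj⟩ := CPn.exists_rep_ne_zero (κ x)
    have h1 : ContMDiffAt 𝓘(ℂ, ℂ) (𝓘(ℂ, Fin d → ℂ).prod 𝓘(ℂ, ℂ)) ω
        (fun t : ℂ => (x, (κ x).rep j ^ e * t)) 0 :=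
      contMDiffAt_const.prodMk (contDiff_const.mul contDiff_id).contMDiff.contMDiffAt
    have h2 := ((hg j (x, (κ x).rep j ^ e * 0) hj).comp (0 : ℂ) h1).mdifferentiableAt (by simp)
    refine h2.congr_of_eventuallyEq (Filter.Eventually.of_forall fun t => ?_)
    simp only [Function.comp_apply]
    rw [← mul_assoc, inv_mul_cancel₀ (pow_ne_zero e hj), one_mul]
  refine ⟨lineSpray κ hκ e g hg0 hg, fun x => velocity (Fin d → ℂ) (g x),
    W, MvPolynomial.eval (κ y).rep c, hcy, ?_,
    fun x => ⟨velocity_mem_verticalImage_lineSpray κ hκ e g hg0 hg x, ?_⟩⟩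
  · set b := MvPolynomial.eval (κ y).rep c with hb
    have h1 : γ y = g y ∘ fun t : ℂ => b⁻¹ * t := by
      funext t
      simp only [Function.comp_apply, g, ← hb, hcy, if_false]
      rw [← mul_assoc, mul_inv_cancel₀ hcy, one_mul]
    have h2 := velocity_comp (γ := fun t : ℂ => b⁻¹ * t) (mul_zero _) (hgdiff y)
      (DifferentiableAt.mdifferentiableAt (by fun_prop))
    have h3 := velocity_comp (γ := fun t : ℂ => t) rfl (hgdiff y)
      (DifferentiableAt.mdifferentiableAt (by fun_prop))
    rw [← h1, velocity_eq_deriv] at h2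
    rw [velocity_eq_deriv] at h3
    have h4 : deriv (fun t : ℂ => b⁻¹ * t) 0 = b⁻¹ • deriv (fun t : ℂ => t) 0 := by
      simp
    rw [h2, h4, map_smul, smul_smul, mul_inv_cancel₀ hcy, one_smul]
    exact h3
  · rw [← velocity_comp (hg0 x) ((hκ x).mdifferentiableAt (by simp)) (hgdiff x)]
    have hFcont : ContinuousAt (fun t : ℂ => F ((κ x).rep, t)) 0 :=
      (hFsmooth.continuous.comp (continuous_const.prodMk continuous_id)).continuousAt
    refine CPn.velocity_curve (H := fun t => F ((κ x).rep, t)) (hFderiv _) (hF0 _)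
      (κ x).rep_nonzero ?_
    filter_upwards [hFcont.eventually_ne (by rw [hF0]; exact (κ x).rep_nonzero)] with t ht
    have := hgF x 1 one_ne_zero t (by rwa [one_smul])
    rw [one_smul, one_pow, one_mul] at this
    exact this

end RegularCurves

/-! ### Regular families of curves from algebraic sprays -/

section AlgebraicSpray

variable {n d : ℕ} {M : Type*} [TopologicalSpace M] [ChartedSpace (Fin d → ℂ) M] {ι : M → CPn n}
  {U Y : TopologicalSpace.Opens M}

lemma ComplexVB.symm_smul {B : Type*} [TopologicalSpace B] (E : ComplexVB B)
    (e : Trivialization E.F (π E.F E.Fib)) (he : e.IsLinear ℂ) {b : B} (hb : b ∈ e.baseSet) (c : ℂ)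
    (v : E.F) : e.symm b (c • v) = c • e.symm b v := by
  rw [← e.symmₗ_apply (R := ℂ) hb, map_smul, e.symmₗ_apply (R := ℂ) hb]

lemma ComplexVB.symm_zero {B : Type*} [TopologicalSpace B] (E : ComplexVB B)
    (e : Trivialization E.F (π E.F E.Fib)) (he : e.IsLinear ℂ) {b : B} (hb : b ∈ e.baseSet) :
    e.symm b (0 : E.F) = 0 := by
  rw [← e.symmₗ_apply (R := ℂ) hb, map_zero]

/-- A Zariski open neighbourhood contains a basic one `{K ≠ 0}`. -/
lemma IsZariskiOpen.exists_basic {B : Type*} {κ : B → CPn n} {S : Set B} (hS : IsZariskiOpen κ S)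
    {b : B} (hb : b ∈ S) :
    ∃ (k : ℕ) (K : MvPolynomial (Fin (n + 1)) ℂ), K.IsHomogeneous k ∧
      MvPolynomial.eval (κ b).rep K ≠ 0 ∧ ∀ b', MvPolynomial.eval (κ b').rep K ≠ 0 → b' ∈ S := by
  obtain ⟨A, hA, rfl⟩ := hS
  obtain ⟨K, hKA, hK⟩ := hb
  obtain ⟨k, hk⟩ := hA K hKA
  exact ⟨k, K, hk, hK, fun b' hb' => ⟨K, hKA, hb'⟩⟩

/-- The substitution of `t a` for the second group of variables, as a polynomial in `t`. -/
def restrictToLine {r : ℕ} (a : Fin r → ℂ) :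
    MvPolynomial (Fin (n + 1) ⊕ Fin r) ℂ →+* Polynomial (MvPolynomial (Fin (n + 1)) ℂ) :=
  MvPolynomial.eval₂Hom (Polynomial.C.comp MvPolynomial.C)
    (Sum.elim (fun i => Polynomial.C (MvPolynomial.X i))
      (fun j => Polynomial.C (MvPolynomial.C (a j)) * Polynomial.X))

lemma polyEval_restrictToLine {r : ℕ} (a : Fin r → ℂ)
    (P : Fin (n + 1) → MvPolynomial (Fin (n + 1) ⊕ Fin r) ℂ) (z : Fin (n + 1) → ℂ) (t : ℂ) :
    polyEval (fun l => restrictToLine a (P l)) z t = evalTuple P z (t • a) := by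
  funext l
  have h : (Polynomial.eval₂RingHom (MvPolynomial.eval z) t).comp (restrictToLine a)
      = MvPolynomial.eval (Sum.elim z (t • a)) := by
    refine MvPolynomial.ringHom_ext (fun c => ?_) (fun i => ?_)
    · simp [restrictToLine]
    · rcases i with i | j
      · simp [restrictToLine]
      · simp [restrictToLine, mul_comm (a j) t, -Polynomial.X_mul_C]
  exact congrArg (fun f : MvPolynomial (Fin (n + 1) ⊕ Fin r) ℂ →+* ℂ => f (P l)) h

lemma evalTuple_smul {r m : ℕ} {P : Fin (n + 1) → MvPolynomial (Fin (n + 1) ⊕ Fin r) ℂ}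
    (hP : ∀ i, (P i).IsWeightedHomogeneous (Sum.elim (fun _ => 1) (fun _ => 0)) m)
    (c : ℂ) (z : Fin (n + 1) → ℂ) (t : Fin r → ℂ) :
    evalTuple P (c • z) t = c ^ m • evalTuple P z t := by
  funext i
  rw [Pi.smul_apply, smul_eq_mul, evalTuple, evalTuple, ← eval_weighted_smul (hP i)]
  congr 2
  funext j
  rcases j with j | j <;> simp

open Classical in
/-- The curves `t ↦ s (t a)` in the values of a spray `s` over `U`, where `a ∈ ℂ^r` defines a vector
in each fibre by means of a trivialization. Outside of `U` the curves are constant. -/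
def AlgebraicSpray.curves (σ : AlgebraicSpray ι U Y)
    (e : Trivialization (Fin σ.rank → ℂ) (π (Fin σ.rank → ℂ) σ.Fib)) (a : Fin σ.rank → ℂ)
    (x : Y) (t : ℂ) : Y :=
  if h : (x : M) ∈ U then σ.toFun ⟨⟨x, h⟩, e.symm ⟨x, h⟩ (t • a)⟩ else x

lemma AlgebraicSpray.curves_of_mem (σ : AlgebraicSpray ι U Y)
    (e : Trivialization (Fin σ.rank → ℂ) (π (Fin σ.rank → ℂ) σ.Fib)) (a : Fin σ.rank → ℂ)
    {x : Y} (h : (x : M) ∈ U) (t : ℂ) :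
    σ.curves e a x t = σ.toFun ⟨⟨x, h⟩, e.symm ⟨x, h⟩ (t • a)⟩ := dif_pos h

/-- Algebraicity of the spray makes the curves `t ↦ s (t a)` a regular family on
`{K ≠ 0}` if this set is contained in the domain of the trivialization. -/
lemma AlgebraicSpray.isRegularCurves (σ : AlgebraicSpray ι U Y)
    {e : Trivialization (Fin σ.rank → ℂ) (π (Fin σ.rank → ℂ) σ.Fib)} (he : e ∈ σ.algAtlas)
    (a : Fin σ.rank → ℂ) {K : MvPolynomial (Fin (n + 1)) ℂ}
    (hKU : ∀ x : M, MvPolynomial.eval (ι x).rep K ≠ 0 → x ∈ U)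
    (hKe : ∀ u : U, MvPolynomial.eval (ι u).rep K ≠ 0 → u ∈ e.baseSet) :
    IsRegularCurves (fun x : Y => ι x) K (σ.curves e a) where
  zero x hx := by
    have h0 := σ.symm_zero e (σ.isLinear e he) (hKe ⟨x, hKU x hx⟩ hx)
    rw [σ.curves_of_mem e a (hKU x hx), zero_smul, h0]
    exact Subtype.ext (σ.map_zero _)
  regular x hx t := by
    obtain ⟨m, P, hPhom, hP0, hP⟩ := σ.isRegular e he ⟨x, hKU x hx⟩ (hKe _ hx) (t • a)
    refine ⟨m, fun l => restrictToLine a (P l), fun c z s => ?_, ?_, fun x' hx' t' h' => ?_⟩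
    · rw [polyEval_restrictToLine, polyEval_restrictToLine, evalTuple_smul hPhom]
    · rw [polyEval_restrictToLine]
      exact hP0
    · rw [polyEval_restrictToLine] at h' ⊢
      rw [CPn.proj_of_ne_zero h', σ.curves_of_mem e a (hKU x' hx')]
      exact hP ⟨x', hKU x' hx'⟩ (hKe _ hx') (t' • a) h'

/-- All vertical derivatives of a spray at a point are velocities of the curves `t ↦ s (t a)`. -/
lemma AlgebraicSpray.exists_velocity_eq (σ : AlgebraicSpray ι U Y)
    {e : Trivialization (Fin σ.rank → ℂ) (π (Fin σ.rank → ℂ) σ.Fib)} (he : e ∈ σ.algAtlas)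
    {y : Y} (hy : (y : M) ∈ U) (hye : (⟨y, hy⟩ : U) ∈ e.baseSet) {v : Fin d → ℂ}
    (hv : v ∈ σ.verticalImage σ.toFun ⟨y, hy⟩) :
    ∃ a : Fin σ.rank → ℂ, velocity (Fin d → ℂ) (σ.curves e a y) = v := by
  set u : U := ⟨y, hy⟩ with hu
  set e₀ := trivializationAt σ.F σ.Fib u with he₀
  obtain ⟨w, hw⟩ : ∃ w : σ.F, differential σ.F (Fin d → ℂ)
      (fun v : σ.F => σ.toFun ⟨u, e₀.symm u v⟩) 0 w = v := hv
  by_cases hd : MDifferentiableAt 𝓘(ℂ, σ.F) 𝓘(ℂ, Fin d → ℂ)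
      (fun v : σ.F => σ.toFun ⟨u, e₀.symm u v⟩) 0
  · refine ⟨(e ⟨u, e₀.symm u w⟩).2, ?_⟩
    have h1 : σ.curves e (e ⟨u, e₀.symm u w⟩).2 y
        = (fun v : σ.F => σ.toFun ⟨u, e₀.symm u v⟩) ∘ fun t : ℂ => t • w := by
      funext t
      rw [σ.curves_of_mem e _ hy]
      simp only [Function.comp_apply]
      congr 2
      have h2 : e.symm u (e ⟨u, e₀.symm u w⟩).2 = e₀.symm u w :=
        e.symm_proj_apply ⟨u, e₀.symm u w⟩ hye
      rw [σ.symm_smul e (σ.isLinear e he) hye,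
        σ.symm_smul e₀ inferInstance (mem_baseSet_trivializationAt σ.F σ.Fib u), h2]
    rw [h1, velocity_comp (x := (0 : σ.F)) (zero_smul ℂ _) hd
      (DifferentiableAt.mdifferentiableAt (by fun_prop)), velocity_eq_deriv]
    have h2 : deriv (fun t : ℂ => t • w) 0 = w := by
      have := (hasDerivAt_id (0 : ℂ)).smul_const w
      rw [one_smul] at this
      exact this.deriv
    rw [h2]
    exact hw
  · -- The derivative has its junk value `0`, which is the velocity of a constant curve.
    refine ⟨0, ?_⟩
    have h1 : σ.curves e 0 y = fun _ => σ.curves e 0 y 0 := by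
      funext t
      rw [σ.curves_of_mem e _ hy, σ.curves_of_mem e _ hy, smul_zero, smul_zero]
    rw [h1, velocity, mfderiv_const, ← hw, differential, mfderiv_zero_of_not_mdifferentiableAt hd]
    rfl

end AlgebraicSpray

/-! ### Linear independence as a Zariski open condition -/

section LinearAlgebra

/-- Linear independence of vectors with polynomial entries is a Zariski open condition: near a
point where the vectors are linearly independent it follows from `det (g (w_k)) ≠ 0`, where `g` is
a linear map that sends them to the standard basis at this point. -/
lemma exists_polynomial_linearIndependent {σ ι : Type*} {m : ℕ}
    [Fintype ι] [DecidableEq ι] (w : Fin m → ι → MvPolynomial σ ℂ) {z : σ → ℂ}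
    (hz : LinearIndependent ℂ (fun k l => MvPolynomial.eval z (w k l))) :
    ∃ R : MvPolynomial σ ℂ, MvPolynomial.eval z R ≠ 0 ∧ ∀ z', MvPolynomial.eval z' R ≠ 0 →
      LinearIndependent ℂ (fun k l => MvPolynomial.eval z' (w k l)) := by
  obtain ⟨g, hg⟩ := LinearMap.exists_leftInverse_of_injective
    (Fintype.linearCombination ℂ (fun k l => MvPolynomial.eval z (w k l)))
    (LinearMap.ker_eq_bot.2 (linearIndependent_iff_injective_fintypeLinearCombination.1 hz))
  let A : Matrix (Fin m) (Fin m) (MvPolynomial σ ℂ) := Matrix.of fun k j =>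
    ∑ l, MvPolynomial.C (g (Pi.single l 1) j) * w k l
  have hA : ∀ z', A.map (MvPolynomial.eval z')
      = Matrix.of fun k => g (fun l => MvPolynomial.eval z' (w k l)) := by
    intro z'
    ext k j
    have h : (fun l => MvPolynomial.eval z' (w k l))
        = ∑ l, MvPolynomial.eval z' (w k l) • (Pi.single l 1 : ι → ℂ) := by
      funext l
      simp [Finset.sum_apply, Pi.single_apply]
    rw [Matrix.map_apply, Matrix.of_apply, h]
    change MvPolynomial.eval z' (∑ l, MvPolynomial.C (g (Pi.single l 1) j) * w k l) = _
    rw [map_sum, map_sum, Finset.sum_apply]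
    refine Finset.sum_congr rfl fun l _ => ?_
    simp [mul_comm]
  have hdet : ∀ z', MvPolynomial.eval z' A.det
      = (Matrix.of fun k => g (fun l => MvPolynomial.eval z' (w k l))).det := by
    intro z'
    rw [RingHom.map_det, RingHom.mapMatrix_apply, hA]
  refine ⟨A.det, ?_, fun z' hz' => ?_⟩
  · rw [hdet]
    have h1 : (Matrix.of fun k => g (fun l => MvPolynomial.eval z (w k l))) = 1 := by
      ext k j
      have h2 := LinearMap.congr_fun hg (Pi.single k 1)
      rw [LinearMap.comp_apply, Fintype.linearCombination_apply_single, one_smul] at h2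
      rw [Matrix.of_apply, h2, LinearMap.id_apply, Matrix.one_apply, Pi.single_apply]
      simp only [eq_comm]
    rw [h1, Matrix.det_one]
    exact one_ne_zero
  · rw [hdet] at hz'
    exact LinearIndependent.of_comp g (Matrix.linearIndependent_rows_of_det_ne_zero hz')

/-- If the kernel of `T` is the line spanned by `z`, vectors are linearly independent together
with `z` if and only if their images under `T` are linearly independent. -/
lemma linearIndependent_cons_iff_of_ker {V V' : Type*} [AddCommGroup V] [Module ℂ V]
    [AddCommGroup V'] [Module ℂ V'] (T : V →ₗ[ℂ] V') {z : V} (hz : z ≠ 0) (hTz : T z = 0)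
    (hker : ∀ v, T v = 0 → ∃ c : ℂ, v = c • z) {m : ℕ} (w : Fin m → V) :
    LinearIndependent ℂ (Fin.cons z w : Fin (m + 1) → V) ↔ LinearIndependent ℂ (T ∘ w) := by
  rw [Fintype.linearIndependent_iff, Fintype.linearIndependent_iff]
  constructor
  · intro h b hb k
    have h1 : T (∑ k, b k • w k) = 0 := by
      rw [map_sum, ← hb]
      simp
    obtain ⟨c, hc⟩ := hker _ h1
    have h2 := h (Fin.cons (-c) b) (by rw [Fin.sum_univ_succ]; simp [hc]) k.succ
    simpa using h2
  · intro h b hb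
    rw [Fin.sum_univ_succ] at hb
    simp only [Fin.cons_zero, Fin.cons_succ] at hb
    have h1 : ∀ k : Fin m, b k.succ = 0 := by
      refine h (fun k => b k.succ) ?_
      have h2 := congrArg T hb
      rw [map_add, map_smul, hTz, smul_zero, zero_add, map_sum, map_zero] at h2
      rw [← h2]
      simp
    have h2 : b 0 = 0 := by
      simpa [h1, hz] using hb
    intro k
    exact Fin.cases h2 h1 k

/-- Among polynomials without common zeros on a set, finitely many suffice (Hilbert's basis
theorem). -/
lemma exists_finset_eval_ne_zero {σ α : Type*} [Finite σ] (R : α → MvPolynomial σ ℂ)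
    (z : α → σ → ℂ) (hR : ∀ x, MvPolynomial.eval (z x) (R x) ≠ 0) :
    ∃ s : Finset α, ∀ x, ∃ y ∈ s, MvPolynomial.eval (z x) (R y) ≠ 0 := by
  classical
  obtain ⟨s, hs, hspan⟩ := (Submodule.fg_span_iff_fg_span_finset_subset (range R)).1
    (IsNoetherian.noetherian (Ideal.span (range R)))
  obtain ⟨t, -, ht⟩ := Finset.subset_set_image_iff.1
    (show (s : Set _) ⊆ R '' univ by simpa using hs)
  refine ⟨t, fun x => ?_⟩
  by_contra! h
  have h1 : Ideal.span (range R) ≤ RingHom.ker (MvPolynomial.eval (z x)) := by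
    change Submodule.span _ (range R) ≤ _
    rw [hspan, Submodule.span_le]
    intro p hp
    rw [← ht] at hp
    obtain ⟨y, hy, rfl⟩ := Finset.mem_image.1 hp
    exact h y hy
  exact hR x (h1 (Ideal.subset_span (mem_range_self x)))

/-- A spanning union of subspaces of `ℂ^d` contains a basis. -/
lemma exists_basis_of_iSup_eq_top {d : ℕ} {κ : Type*} (V : κ → Submodule ℂ (Fin d → ℂ))
    (hV : ⨆ j, V j = ⊤) :
    ∃ v : Fin d → Fin d → ℂ, LinearIndependent ℂ v ∧ ∀ k, ∃ j, v k ∈ V j := by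
  obtain ⟨b, hbV, hspan, hb⟩ := exists_linearIndependent ℂ (⋃ j, (V j : Set (Fin d → ℂ)))
  rw [Submodule.span_iUnion] at hspan
  simp only [Submodule.span_eq, hV] at hspan
  let B : Module.Basis b ℂ (Fin d → ℂ) := Module.Basis.mk hb (by simp [hspan])
  have e : Fin d ≃ b := (Pi.basisFun ℂ (Fin d)).indexEquiv B
  exact ⟨fun k => e k, hb.comp e e.injective, fun k => by simpa using hbV (e k).2⟩

end LinearAlgebra

/-! ### Finitely many dominating sprays -/

lemma isSubelliptic_of_finite {d : ℕ} {X : Type*} [TopologicalSpace X]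
    [ChartedSpace (Fin d → ℂ) X] {α : Type*} [Finite α] (S : α → HolomorphicSpray d X)
    (hS : ∀ x : X, ⨆ a, (S a).verticalImage (S a).toFun x = (⊤ : Submodule ℂ (Fin d → ℂ))) :
    IsSubelliptic d X := by
  obtain ⟨k, ⟨e⟩⟩ := Finite.exists_equiv_fin α
  refine ⟨k, S ∘ e.symm, fun x => ?_⟩
  rw [← hS x]
  exact e.symm.iSup_comp (g := fun a => (S a).verticalImage (S a).toFun x)

end

theorem proposition1p3 {n d : ℕ} {M : Type*} [TopologicalSpace M]
    [ChartedSpace (Fin d → ℂ) M] [IsManifold 𝓘(ℂ, Fin d → ℂ) ω M]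
    -- `M` is a projective algebraic manifold: a closed complex submanifold of projective space
    (ι : M → CPn n)
    (hι : IsSmoothEmbedding 𝓘(ℂ, Fin d → ℂ) 𝓘(ℂ, Fin n → ℂ) ω ι)
    (hclosed : IsClosed (Set.range ι))
    -- `Y` is a quasi-projective manifold: a Zariski open subset of `M`
    (Y : TopologicalSpace.Opens M) (hY : IsZariskiOpen ι (Y : Set M))
    -- each point has a Zariski open neighbourhood with finitely many algebraic sprays with
    -- values in `Y` that together dominate at the point
    (hspray : ∀ y ∈ Y, ∃ U : TopologicalSpace.Opens M, IsZariskiOpen ι (U : Set M) ∧ U ≤ Y ∧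
      ∃ (hyU : y ∈ U) (k : ℕ) (σ : Fin k → AlgebraicSpray ι U Y),
        ⨆ j, (σ j).verticalImage (σ j).toFun ⟨y, hyU⟩ = (⊤ : Submodule ℂ (Fin d → ℂ))) :
    IsSubelliptic d Y := by
  classical
  let κ : Y → CPn n := fun x => ι x
  have hκ : ContMDiff 𝓘(ℂ, Fin d → ℂ) 𝓘(ℂ, Fin n → ℂ) ω κ :=
    hι.contMDiff.comp contMDiff_subtype_val
  have hval : IsSmoothEmbedding 𝓘(ℂ, Fin d → ℂ) 𝓘(ℂ, Fin d → ℂ) ω (Subtype.val : Y → M) :=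
    IsSmoothEmbedding.of_opens Y
  -- Maps into `Y` are holomorphic if they are so as maps to projective space.
  have hlift : ∀ (f : Y × ℂ → Y) (p : Y × ℂ),
      ContMDiffAt (𝓘(ℂ, Fin d → ℂ).prod 𝓘(ℂ, ℂ)) 𝓘(ℂ, Fin n → ℂ) ω (κ ∘ f) p →
      ContMDiffAt (𝓘(ℂ, Fin d → ℂ).prod 𝓘(ℂ, ℂ)) 𝓘(ℂ, Fin d → ℂ) ω f p := by
    intro f p hf
    have h1 : ContinuousAt f p :=
      (hι.isEmbedding.comp hval.isEmbedding).continuousAt_iff.2 hf.continuousAt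
    have h2 := (ContMDiffAt.iff_comp_isImmersionAt (f := Subtype.val ∘ f)
      (hι.isImmersion.isImmersionAt (f p))).2
      ⟨continuous_subtype_val.continuousAt.comp h1, hf⟩
    exact (ContMDiffAt.iff_comp_isImmersionAt (hval.isImmersion.isImmersionAt (f p))).2 ⟨h1, h2⟩
  have hdκ : ∀ x, Function.Injective (differential (Fin d → ℂ) (Fin n → ℂ) κ x) := by
    intro x
    have h1 : differential (Fin d → ℂ) (Fin n → ℂ) κ x
        = (differential (Fin d → ℂ) (Fin n → ℂ) ι x).comp
          (differential (Fin d → ℂ) (Fin d → ℂ) (Subtype.val : Y → M) x) :=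
      mfderiv_comp x ((hι.contMDiff x).mdifferentiableAt (by simp))
        ((hval.contMDiff x).mdifferentiableAt (by simp))
    rw [h1]
    exact (hι.isImmersion.differential_injective x.1).comp
      (hval.isImmersion.differential_injective x)
  -- Tangent vectors `ζ` of `Y` are compared with representatives `w` in `ℂ^(n+1)` of their images
  -- in the tangent space of projective space.
  have hindep : ∀ (x : Y) (ζ : Fin d → Fin d → ℂ) (w : Fin d → Fin (n + 1) → ℂ),
      (∀ k, differential (Fin d → ℂ) (Fin n → ℂ) κ x (ζ k) = CPn.tangentProj (κ x).rep (w k)) →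
      (LinearIndependent ℂ (Fin.cons (κ x).rep w : Fin (d + 1) → Fin (n + 1) → ℂ) ↔
        LinearIndependent ℂ ζ) := by
    intro x ζ w h
    rw [linearIndependent_cons_iff_of_ker (CPn.tangentProj (κ x).rep).toLinearMap
      (κ x).rep_nonzero (CPn.tangentProj_self (κ x).rep_nonzero)
      (fun v hv => CPn.exists_eq_smul_of_tangentProj_eq_zero (κ x).rep_nonzero hv),
      ← LinearMap.linearIndependent_iff
        (differential (Fin d → ℂ) (Fin n → ℂ) κ x).toLinearMap
        (LinearMap.ker_eq_bot.2 (hdκ x))]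
    have : (differential (Fin d → ℂ) (Fin n → ℂ) κ x).toLinearMap ∘ ζ
        = (CPn.tangentProj (κ x).rep).toLinearMap ∘ w := funext h
    rw [this]
  -- For each point there are `d` sprays on `Y` which dominate where some polynomial, nonzero at
  -- this point, does not vanish.
  have hlocal : ∀ y : Y, ∃ (S : Fin d → HolomorphicSpray d Y) (R : MvPolynomial (Fin (n + 1)) ℂ),
      MvPolynomial.eval (κ y).rep R ≠ 0 ∧ ∀ x : Y, MvPolynomial.eval (κ x).rep R ≠ 0 →
        ⨆ k, (S k).verticalImage (S k).toFun x = (⊤ : Submodule ℂ (Fin d → ℂ)) := by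
    intro y
    obtain ⟨U, hU, hUY, hyU, k₀, σ, hσ⟩ := hspray y y.2
    obtain ⟨v, hv, hvσ⟩ := exists_basis_of_iSup_eq_top _ hσ
    obtain ⟨k₂, K₂, hK₂hom, hK₂y, hK₂⟩ := hU.exists_basic hyU
    have hone : ∀ k, ∃ (S : HolomorphicSpray d Y) (ζ : Y → Fin d → ℂ)
        (W : Fin (n + 1) → MvPolynomial (Fin (n + 1)) ℂ) (a : ℂ), a ≠ 0 ∧ ζ y = a • v k ∧
        ∀ x, ζ x ∈ S.verticalImage S.toFun x ∧
          differential (Fin d → ℂ) (Fin n → ℂ) κ x (ζ x) =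
            CPn.tangentProj (κ x).rep (fun l => MvPolynomial.eval (κ x).rep (W l)) := by
      intro k
      obtain ⟨j, hj⟩ := hvσ k
      obtain ⟨e, he, hye⟩ := (σ j).cover ⟨y, hyU⟩
      obtain ⟨k₁, K₁, hK₁hom, hK₁y, hK₁⟩ := ((σ j).isZariskiOpen_baseSet e he).exists_basic hye
      obtain ⟨a, ha⟩ := (σ j).exists_velocity_eq he hyU hye hj
      have hγ : IsRegularCurves κ (K₁ * K₂) ((σ j).curves e a) := by
        refine (σ j).isRegularCurves he a (fun x hx => hK₂ x ?_) (fun u hu => hK₁ u ?_)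
        · rw [map_mul] at hx
          exact right_ne_zero_of_mul hx
        · rw [map_mul] at hu
          exact left_ne_zero_of_mul hu
      have hy : MvPolynomial.eval (κ y).rep (K₁ * K₂) ≠ 0 := by
        rw [map_mul]
        exact mul_ne_zero hK₁y hK₂y
      rw [← ha]
      exact hγ.exists_spray hκ hlift (hK₁hom.mul hK₂hom) hy
    choose S ζ W a ha hζy hS using hone
    -- The coordinate vector `z` itself is the tuple of variables.
    let w : Fin (d + 1) → Fin (n + 1) → MvPolynomial (Fin (n + 1)) ℂ :=
      Fin.cons MvPolynomial.X W
    have hw : ∀ x : Y, (fun k l => MvPolynomial.eval (κ x).rep (w k l))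
        = (Fin.cons (κ x).rep (fun k l => MvPolynomial.eval (κ x).rep (W k l)) :
          Fin (d + 1) → Fin (n + 1) → ℂ) := by
      intro x
      funext k
      refine Fin.cases ?_ (fun k => ?_) k
      · funext l; simp [w]
      · funext l; simp [w]
    have hiff : ∀ x : Y, LinearIndependent ℂ (fun k l => MvPolynomial.eval (κ x).rep (w k l)) ↔
        LinearIndependent ℂ (fun k => ζ k x) := by
      intro x
      rw [hw]
      exact hindep x _ _ fun k => (hS k x).2
    have hy : LinearIndependent ℂ (fun k => ζ k y) := by
      have := hv.units_smul fun k => Units.mk0 (a k) (ha k)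
      convert this using 1
      funext k
      exact hζy k
    obtain ⟨R, hRy, hR⟩ := exists_polynomial_linearIndependent w ((hiff y).2 hy)
    refine ⟨S, R, hRy, fun x hx => ?_⟩
    have hζ := (hiff x).1 (hR _ hx)
    have hspan := hζ.span_eq_top_of_card_eq_finrank' (by simp)
    rw [eq_top_iff, ← hspan, Submodule.span_le]
    rintro _ ⟨k, rfl⟩
    exact Submodule.mem_iSup_of_mem (p := fun k => (S k).verticalImage (S k).toFun x) k (hS k x).1
  choose S R hRy hR using hlocal
  obtain ⟨s, hs⟩ := exists_finset_eval_ne_zero R (fun y => (κ y).rep) hRy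
  refine isSubelliptic_of_finite (α := s × Fin d) (fun p => S p.1 p.2) fun x => ?_
  obtain ⟨y, hy, hyx⟩ := hs x
  rw [eq_top_iff, ← hR y x hyx, iSup_le_iff]
  intro k
  exact le_iSup (fun p : s × Fin d => (S p.1 p.2).verticalImage (S p.1 p.2).toFun x) (⟨y, hy⟩, k)
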